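/- Let $d\in\{2,3\}$, $k>0$, $\kappa_0,\kappa_1>0$, $n>0$, and put $\mathsf n_0=1+i\kappa_0$, $\mathsf n_1=n^2+i\kappa_1$. Let $D\subset\mathbb R^d$ be a bounded open set with volume $|D|$, let $\alpha\in(0,1]$, and let $\rho:\mathbb R^d\to[0,\infty)$ satisfy $\operatorname{supp}\rho\subset\overline D$ and $$[\rho]_\alpha=\sup_{x\ne y}\frac{|\rho(x)-\rho(y)|}{|x-y|^\alpha}<\infty .$$ For $\varepsilon>0$ let $\Pi_\varepsilon$ be a Poisson point process on $\mathbb R^d$ with scale $\varepsilon$ and density $\rho$, that is, a random countable subset of $\mathbb R^d$ such that for every Borel set $A$ the number $N_\varepsilon(A)$ of points of $\Pi_\varepsilon\cap A$ is a random variable with the Poisson law of mean $\frac{1}{V_d\varepsilon^d}\int_A\rho(x)\,dx$ ($V_d$ being the volume of the unit ball), and $N_\varepsilon(A_1),\dots,N_\varepsilon(A_m)$ are independent for disjoint Borel sets $A_1,\dots,A_m$. Put $\mathsf n_\varepsilon(x)=\mathsf n_1$ if $\operatorname{dist}(x,\Pi_\varepsilon)<\varepsilon$ and $\mathsf n_\varepsilon(x)=\mathsf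 n_0$ otherwise (with $\operatorname{dist}(x,\varnothing)=\infty$), and $$\mu(x)=p(x)\,\mathsf n_1+(1-p(x))\,\mathsf n_0,\qquad p(x)=1-e^{-\rho(x)} .$$ For $f\in L^2(\mathbb R^d;\mathbb C)$ consider, in the sense of distributions on $\mathbb R^d$, the equations $$-(\Delta+k^2\mathsf n_\varepsilon)u_\varepsilon=f\quad(1)\qquad\text{and}\qquad-(\Delta+k^2\mu)u=f\quad(2).$$ Then: (a) For every $f\in L^2(\mathbb R^d)$, equation (2) has a unique solution $u\in L^2(\mathbb R^d)$ and, for every realization of $\Pi_\varepsilon$, equation (1) has a unique solution $u_\varepsilon\in L^2(\mathbb R^d)$. (b) (2) is the homogenized equation of (1): $\lim_{\varepsilon\to0}\mathbb E[\mathsf n_\varepsilon(x)]=\mu(x)$ for every $x\in\mathbb R^d$, and $\lim_{\varepsilon\to0}\mathbb E\|u_\varepsilon-u\|_{L^2(\mathbb R^d)}^2=0$ for every $f\in L^2(\mathbb R^d)$. (c) There is a constant $C$ depending only on $k,\mathsf n_0,\mathsf n_1,d,\alpha,[\rho]_\alpha,|D|$ such that for all $\varepsilon>0$ and all $f\in L^2(\mathbb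 R^d)$ the random variable $\|u_\varepsilon-u\|_{L^2(\mathbb R^d)}^2$ is integrable and $$\mathbb E\|u_\varepsilon-u\|_{L^2(\mathbb R^d)}^2\le C\,\varepsilon^{2\alpha}\,\|u\|_{L^2(\mathbb R^d)}^2 .$$ -/

import Mathlib

open MeasureTheory ProbabilityTheory Filter Topology
open scoped ENNReal NNReal SchwartzMap

noncomputable section

namespace PoissonHelmholtz

/-- The space `ℝ^d` with its Euclidean norm. -/
abbrev Space (d : ℕ) : Type := EuclideanSpace ℝ (Fin d)

/-- The complex Hilbert space `L²(ℝ^d)`. -/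
abbrev L2 (d : ℕ) : Type := Lp ℂ 2 (volume : Measure (Space d))

/-- The mean measure `λ_ε(A) = (V_d ε^d)⁻¹ ∫_A ρ`, with `V_d` the volume of the unit ball. -/
def meanCount {d : ℕ} (ε : ℝ) (ρ : Space d → ℝ) (A : Set (Space d)) : ℝ≥0∞ :=
  (∫⁻ x in A, ENNReal.ofReal (ρ x)) /
    (volume (Metric.ball (0 : Space d) 1) * ENNReal.ofReal ε ^ d)

/-- The number `N(A)` of points of the random set `S` in `A`. -/
def pointCount {Ω : Type*} {d : ℕ} (S : Ω → Set (Space d)) (A : Set (Space d)) (ω : Ω) : ℕ∞ :=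
  (S ω ∩ A).encard

/-- `S` is a Poisson point process on `ℝ^d` with heterogeneity scale `ε` and density `ρ`:
a random countable set whose counts in Borel sets are random variables that follow the Poisson
law with mean `λ_ε(A)` (the Poisson law with infinite mean being the unit mass at `∞`) and that
are independent for disjoint sets. -/
structure IsPoissonProcess {Ω : Type*} [MeasurableSpace Ω] {d : ℕ} (P : Measure Ω) (ε : ℝ)
    (ρ : Space d → ℝ) (S : Ω → Set (Space d)) : Prop where
  countable : ∀ ω, (S ω).Countable
  measurable_count : ∀ A, MeasurableSet A → Measurable (pointCount S A)
  law : ∀ A, MeasurableSet A → meanCount ε ρ A ≠ ∞ →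
    P.map (pointCount S A) =
      (poissonMeasure (meanCount ε ρ A).toNNReal).map (fun n : ℕ => (n : ℕ∞))
  law_top : ∀ A, MeasurableSet A → meanCount ε ρ A = ∞ → ∀ᵐ ω ∂P, pointCount S A ω = ⊤
  indep : ∀ (m : ℕ) (A : Fin m → Set (Space d)), (∀ i, MeasurableSet (A i)) →
    Pairwise (fun i j => Disjoint (A i) (A j)) → iIndepFun (fun i => pointCount S (A i)) P

/-- The complex refractive index `1 + i κ₀` of water. -/
def waterIndex (κ₀ : ℝ) : ℂ := 1 + Complex.I * (κ₀ : ℂ)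

/-- The complex refractive index `n² + i κ₁` of sand, `n` being the real refractive index. -/
def sandIndex (n κ₁ : ℝ) : ℂ := (n : ℂ) ^ 2 + Complex.I * (κ₁ : ℂ)

open Classical in
/-- The two-phase coefficient of the cloud of `ε`-balls centred at the points of `S`: it is `n₁`
where `dist(x, S) < ε` and `n₀` elsewhere. The distance to the empty set is `∞`. -/
def cloudIndex {d : ℕ} (n₀ n₁ : ℂ) (ε : ℝ) (S : Set (Space d)) (x : Space d) : ℂ :=
  if Metric.infEDist x S < ENNReal.ofReal ε then n₁ else n₀

/-- The macroscopic probability `p = 1 - exp (-ρ)` of the inclusions. -/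
def macroProb {d : ℕ} (ρ : Space d → ℝ) (x : Space d) : ℝ := 1 - Real.exp (-ρ x)

/-- The effective coefficient `μ = p n₁ + (1 - p) n₀`. -/
def effectiveIndex {d : ℕ} (n₀ n₁ : ℂ) (ρ : Space d → ℝ) (x : Space d) : ℂ :=
  (macroProb ρ x : ℂ) * n₁ + (1 - (macroProb ρ x : ℂ)) * n₀

/-- `u ∈ L²(ℝ^d)` solves `-(Δ + k² q) u = f` on `ℝ^d` in the sense of (tempered) distributions:
both derivatives are moved to the test function. Here `q` is a bounded measurable coefficient. -/
def IsHelmholtzSolution {d : ℕ} (k : ℝ) (q : Space d → ℂ) (f u : L2 d) : Prop :=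
  ∀ φ : 𝓢(Space d, ℂ),
    -((∫ x, u x * Laplacian.laplacian (φ : Space d → ℂ) x) + (k : ℂ) ^ 2 * ∫ x, q x * u x * φ x) =
      ∫ x, f x * φ x

end PoissonHelmholtz

end

open PoissonHelmholtz

/-!
Write `Δ + k² q = (Δ + i k² t) + k² (q - i t)`. For large `t` the two values of the random
coefficient, which lie in the open upper half plane, and hence also their convex combinations, lie
in the disc of radius `θ t` about `i t` for some `θ < 1`. As a Fourier multiplier,
`T = (Δ + i k² t)⁻¹` has norm at most `(k² t)⁻¹` on `L²`, so that `-(Δ + k² q) u = f` is the fixed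
point equation `u = T (-(f + k² (q - i t) u))` of a contraction with factor `θ`
(`isHelmholtzSolution_iff`, `contractingWith_helmholtzMap`). This gives unique solvability, the
measurability of `u_ε` in the realization (as a limit of iterates), and the stability estimate
`‖u_ε - u‖ ≤ k² / (1 - θ) ‖T ((n_ε - μ) u)‖` (`norm_sub_le_norm_resolvent`).

The difference `n_ε - μ` is a bias plus a centred field. The bias is at most `[ρ]_α ε^α` up to the
factor `n₁ - n₀`, because a ball of radius `ε` about `x` contains no point of the process with
probability `exp (-a)`, where `a` is the average of `ρ` over the ball
(`IsPoissonProcess.abs_integral_cloudIndicator_sub_le`). The values of the centred field `Z` at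
points of distance at least `2ε` are determined by the process in disjoint balls, so they are
uncorrelated. Hence for every frequency `ξ` the second moment of the Fourier transform of `Z u` at
`ξ` is bounded by an integral of `|u(y)| |u(z)|` over `|y - z| < 2ε`, which is of order
`ε^d ‖u‖²` (`IsShortRange.lintegral_enorm_integral_sq_le`). In dimension less than four the symbol
of `T` is square integrable, and Plancherel's theorem yields `𝔼 ‖T (Z u)‖² ≤ C ε^d ‖u‖²`
(`IsShortRange.integral_norm_resolvent_sq_le`). As `2 ≤ d` and `α ≤ 1`, this is at most
`C ε^(2α) ‖u‖²` for `ε ≤ 1`; for larger `ε` the trivial bound suffices. The constant depends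
neither on the domain nor on its volume.
-/

namespace PoissonHelmholtz
open FourierTransform

variable {d : ℕ}

/-! ### Multiplication operators and the resolvent of the Laplacian -/

/-- Multiplication by an essentially bounded function `q`, as an operator on `L²(ℝ^d)`. -/
noncomputable def mulOp (q : Space d → ℂ) (hq : MemLp q ∞ (volume : Measure (Space d))) :
    L2 d →L[ℂ] L2 d :=
  (ContinuousLinearMap.mul ℂ ℂ).holderL volume ∞ 2 2 (hq.toLp q)

theorem mulOp_ae (q : Space d → ℂ) (hq : MemLp q ∞ (volume : Measure (Space d))) (u : L2 d) :
    mulOp q hq u =ᵐ[volume] fun x => q x * u x := by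
  filter_upwards [(ContinuousLinearMap.mul ℂ ℂ).coeFn_holder (r := 2) (hq.toLp q) u,
    hq.coeFn_toLp] with x h1 h2
  simp only [mulOp, ContinuousLinearMap.holderL_apply_apply, h1, h2, ContinuousLinearMap.mul_apply']

theorem norm_mulOp_le {q : Space d → ℂ} (hq : MemLp q ∞ (volume : Measure (Space d))) {B : ℝ}
    (hB : ∀ x, ‖q x‖ ≤ B) (u : L2 d) : ‖mulOp q hq u‖ ≤ B * ‖u‖ := by
  apply Lp.norm_le_mul_norm_of_ae_le_mul
  filter_upwards [mulOp_ae q hq u] with x hx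
  rw [hx, norm_mul]
  gcongr
  exact hB x

theorem memLp_top_of_measurable_of_bound {q : Space d → ℂ} (hq : Measurable q) {B : ℝ}
    (hB : ∀ x, ‖q x‖ ≤ B) : MemLp q ∞ (volume : Measure (Space d)) :=
  memLp_top_of_bound hq.aestronglyMeasurable B (ae_of_all _ hB)

/-- The Fourier symbol `(iτ - (2π)²|ξ|²)⁻¹` of `(Δ + iτ)⁻¹`. -/
noncomputable def resolventSymbol (τ : ℝ) (ξ : Space d) : ℂ :=
  (Complex.I * (τ : ℂ) - (((2 * Real.pi) ^ 2 * ‖ξ‖ ^ 2 : ℝ) : ℂ))⁻¹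

theorem norm_resolventSymbol_sq (τ : ℝ) (ξ : Space d) :
    ‖resolventSymbol τ ξ‖ ^ 2 = (τ ^ 2 + ((2 * Real.pi) ^ 2 * ‖ξ‖ ^ 2) ^ 2)⁻¹ := by
  rw [resolventSymbol, norm_inv, inv_pow, Complex.sq_norm, Complex.normSq_apply]
  generalize (2 * Real.pi) ^ 2 * ‖ξ‖ ^ 2 = s
  simp
  ring_nf

theorem continuous_symbol_inv (τ : ℝ) : Continuous fun ξ : Space d =>
    Complex.I * (τ : ℂ) - (((2 * Real.pi) ^ 2 * ‖ξ‖ ^ 2 : ℝ) : ℂ) := by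
  fun_prop

theorem symbol_inv_ne_zero {τ : ℝ} (hτ : 0 < τ) (ξ : Space d) :
    Complex.I * (τ : ℂ) - (((2 * Real.pi) ^ 2 * ‖ξ‖ ^ 2 : ℝ) : ℂ) ≠ 0 := by
  intro h
  generalize (2 * Real.pi) ^ 2 * ‖ξ‖ ^ 2 = s at h
  have := congrArg Complex.im h
  simp at this
  exact hτ.ne' this

theorem measurable_resolventSymbol (τ : ℝ) : Measurable (resolventSymbol τ : Space d → ℂ) :=
  (continuous_symbol_inv τ).measurable.inv

theorem norm_resolventSymbol_le {τ : ℝ} (hτ : 0 < τ) (ξ : Space d) :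
    ‖resolventSymbol τ ξ‖ ≤ τ⁻¹ := by
  have h := norm_resolventSymbol_sq τ ξ
  have : ‖resolventSymbol τ ξ‖ ^ 2 ≤ (τ⁻¹) ^ 2 := by
    rw [h, inv_pow]
    gcongr
    nlinarith [sq_nonneg ((2 * Real.pi) ^ 2 * ‖ξ‖ ^ 2)]
  exact (sq_le_sq₀ (norm_nonneg _) (by positivity)).1 this

theorem memLp_resolventSymbol {τ : ℝ} (hτ : 0 < τ) :
    MemLp (resolventSymbol τ : Space d → ℂ) ∞ volume :=
  memLp_top_of_measurable_of_bound (measurable_resolventSymbol τ) (norm_resolventSymbol_le hτ)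

/-- The symbol decays like `|ξ|⁻²`, hence is square integrable in dimension less than four. -/
theorem integrable_norm_resolventSymbol_sq {τ : ℝ} (hτ : 0 < τ) (hd : d < 4) :
    Integrable (fun ξ : Space d => ‖resolventSymbol τ ξ‖ ^ 2) volume := by
  have h := integrable_one_add_norm (μ := (volume : Measure (Space d))) (r := 4)
    (by simp; exact_mod_cast hd)
  have hm : (0:ℝ) < min (τ ^ 2) 1 := by positivity
  refine (h.const_mul (8 / min (τ ^ 2) 1)).mono'
    ((measurable_resolventSymbol τ).norm.pow_const 2).aestronglyMeasurable (ae_of_all _ fun ξ => ?_)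
  rw [Real.norm_of_nonneg (by positivity), norm_resolventSymbol_sq]
  have e : (1 + ‖ξ‖) ^ (-4 : ℝ) = ((1 + ‖ξ‖) ^ 4)⁻¹ := by
    rw [Real.rpow_neg (by positivity)]; norm_cast
  rw [e, ← div_eq_mul_inv, div_div, inv_eq_one_div,
    div_le_div_iff₀ (by positivity) (by positivity)]
  have hpi : (1:ℝ) ≤ (2 * Real.pi) ^ 2 := by nlinarith [Real.pi_gt_three]
  have h1 : (1 + ‖ξ‖) ^ 4 ≤ 8 * (1 + ‖ξ‖ ^ 4) := by
    nlinarith [sq_nonneg (1 - ‖ξ‖), sq_nonneg (1 - ‖ξ‖ ^ 2), sq_nonneg ((1 - ‖ξ‖) ^ 2),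
      sq_nonneg (‖ξ‖ * (1 - ‖ξ‖)), norm_nonneg ξ]
  have h2 : ‖ξ‖ ^ 4 ≤ ((2 * Real.pi) ^ 2 * ‖ξ‖ ^ 2) ^ 2 := by
    have : ‖ξ‖ ^ 2 ≤ (2 * Real.pi) ^ 2 * ‖ξ‖ ^ 2 := le_mul_of_one_le_left (by positivity) hpi
    calc ‖ξ‖ ^ 4 = (‖ξ‖ ^ 2) ^ 2 := by ring
      _ ≤ _ := by gcongr
  have h3 : min (τ ^ 2) 1 * ‖ξ‖ ^ 4 ≤ ‖ξ‖ ^ 4 :=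
    mul_le_of_le_one_left (by positivity) (min_le_right _ _)
  calc 1 * (min (τ ^ 2) 1 * (1 + ‖ξ‖) ^ 4)
      ≤ min (τ ^ 2) 1 * (8 * (1 + ‖ξ‖ ^ 4)) := by rw [one_mul]; gcongr
    _ = 8 * (min (τ ^ 2) 1 + min (τ ^ 2) 1 * ‖ξ‖ ^ 4) := by ring
    _ ≤ 8 * (τ ^ 2 + ((2 * Real.pi) ^ 2 * ‖ξ‖ ^ 2) ^ 2) := by
      gcongr
      · exact min_le_left _ _
      · exact h3.trans h2

/-- The operator `(Δ + iτ)⁻¹` on `L²(ℝ^d)`, as a Fourier multiplier. -/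
noncomputable def resolvent {τ : ℝ} (hτ : 0 < τ) : L2 d →L[ℂ] L2 d :=
  ((Lp.fourierTransformₗᵢ (Space d) ℂ).symm : L2 d →L[ℂ] L2 d) ∘L
    mulOp (resolventSymbol τ) (memLp_resolventSymbol hτ) ∘L
      ((Lp.fourierTransformₗᵢ (Space d) ℂ) : L2 d →L[ℂ] L2 d)

theorem fourier_resolvent {τ : ℝ} (hτ : 0 < τ) (g : L2 d) :
    𝓕 (resolvent hτ g) = mulOp (resolventSymbol τ) (memLp_resolventSymbol hτ) (𝓕 g : L2 d) :=
  (Lp.fourierTransformₗᵢ (Space d) ℂ).apply_symm_apply _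

theorem norm_resolvent_le {τ : ℝ} (hτ : 0 < τ) (g : L2 d) : ‖resolvent hτ g‖ ≤ τ⁻¹ * ‖g‖ := by
  rw [← Lp.norm_fourier_eq, fourier_resolvent, ← Lp.norm_fourier_eq g]
  exact norm_mulOp_le _ (norm_resolventSymbol_le hτ) _

/-- Parseval's identity in bilinear form, between `L²` and the Schwartz space. -/
theorem integral_fourier_mul (u : L2 d) (φ : 𝓢(Space d, ℂ)) :
    ∫ x, (𝓕 u : L2 d) x * φ x = ∫ x, u x * (𝓕 φ : 𝓢(Space d, ℂ)) x := by
  have h := congrArg (fun T : 𝓢'(Space d, ℂ) => T φ) (Lp.fourier_toTemperedDistribution_eq u)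
  simp only [TemperedDistribution.fourier_apply, Lp.toTemperedDistribution_apply, smul_eq_mul] at h
  simp_rw [mul_comm _ (φ _), mul_comm (u _)]
  exact h.symm

theorem fourier_laplacian (φ : 𝓢(Space d, ℂ)) (ξ : Space d) :
    (𝓕 (Laplacian.laplacian φ : 𝓢(Space d, ℂ)) : 𝓢(Space d, ℂ)) ξ =
      -(((2 * Real.pi) ^ 2 * ‖ξ‖ ^ 2 : ℝ) : ℂ) * (𝓕 φ : 𝓢(Space d, ℂ)) ξ := by
  rw [SchwartzMap.laplacian_eq_fourierMultiplierCLM, ← FourierTransform.fourierCLM_apply (R := ℝ),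
    map_smul, FourierTransform.fourierCLM_apply, SchwartzMap.fourierMultiplierCLM_apply,
    FourierTransform.fourier_fourierInv_eq, _root_.smul_apply,
    SchwartzMap.smulLeftCLM_apply_apply (by fun_prop)]
  simp [mul_assoc]

theorem fourierInv_laplacian (φ : 𝓢(Space d, ℂ)) (ξ : Space d) :
    (𝓕⁻ (Laplacian.laplacian φ : 𝓢(Space d, ℂ)) : 𝓢(Space d, ℂ)) ξ =
      -(((2 * Real.pi) ^ 2 * ‖ξ‖ ^ 2 : ℝ) : ℂ) * (𝓕⁻ φ : 𝓢(Space d, ℂ)) ξ := by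
  have h := fourier_laplacian φ (-ξ)
  rw [norm_neg] at h
  simpa [SchwartzMap.fourierInv_apply_eq] using h

theorem integral_mul_laplacian (u : L2 d) (φ : 𝓢(Space d, ℂ)) :
    ∫ x, u x * Laplacian.laplacian (φ : Space d → ℂ) x =
      ∫ ξ, (𝓕 u : L2 d) ξ * (-(((2 * Real.pi) ^ 2 * ‖ξ‖ ^ 2 : ℝ) : ℂ) * (𝓕⁻ φ : 𝓢(Space d, ℂ)) ξ) := by
  simp_rw [← fourierInv_laplacian, integral_fourier_mul, FourierTransform.fourier_fourierInv_eq,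
    SchwartzMap.laplacian_apply]

theorem integral_mul_eq_fourier (u : L2 d) (φ : 𝓢(Space d, ℂ)) :
    ∫ x, u x * φ x = ∫ ξ, (𝓕 u : L2 d) ξ * (𝓕⁻ φ : 𝓢(Space d, ℂ)) ξ := by
  simp_rw [integral_fourier_mul, FourierTransform.fourier_fourierInv_eq]

theorem integrable_mul_schwartz (u : L2 d) (φ : 𝓢(Space d, ℂ)) :
    Integrable (fun x => u x * φ x) :=
  (Lp.memLp u).integrable_mul (φ.memLp 2 volume)

/-- A locally integrable function that vanishes as a tempered distribution is zero. -/
theorem ae_eq_zero_of_integral_schwartz_eq_zero {F : Space d → ℂ} (hF : LocallyIntegrable F)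
    (h : ∀ φ : 𝓢(Space d, ℂ), ∫ x, F x * φ x = 0) : F =ᵐ[volume] 0 := by
  refine ae_eq_zero_of_integral_contDiff_smul_eq_zero hF fun g hg hgs => ?_
  have hc : HasCompactSupport (fun x => (g x : ℂ)) := hgs.comp_left (g := Complex.ofReal) rfl
  have := h (hc.toSchwartzMap (Complex.ofRealCLM.contDiff.comp hg))
  rw [← this]
  refine integral_congr_ae (ae_of_all _ fun x => ?_)
  change _ = F x * (g x : ℂ)
  simp [mul_comm]

/-- Distributional characterization of `(Δ + iτ)⁻¹` on `L²`. -/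
theorem eq_resolvent_iff {τ : ℝ} (hτ : 0 < τ) (u g : L2 d) :
    u = resolvent hτ g ↔ ∀ φ : 𝓢(Space d, ℂ),
      (∫ x, u x * Laplacian.laplacian (φ : Space d → ℂ) x) + Complex.I * (τ : ℂ) * ∫ x, u x * φ x =
        ∫ x, g x * φ x := by
  -- On the Fourier side both statements say that `û` times the inverse symbol is `ĝ`.
  have key : ∀ φ : 𝓢(Space d, ℂ),
      (∫ x, u x * Laplacian.laplacian (φ : Space d → ℂ) x) + Complex.I * (τ : ℂ) * ∫ x, u x * φ x =
        ∫ ξ, ((Complex.I * (τ : ℂ) - (((2 * Real.pi) ^ 2 * ‖ξ‖ ^ 2 : ℝ) : ℂ)) * (𝓕 u : L2 d) ξ) *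
          (𝓕⁻ φ : 𝓢(Space d, ℂ)) ξ := by
    intro φ
    rw [integral_mul_laplacian, integral_mul_eq_fourier, ← integral_const_mul, ← integral_add]
    · congr 1; ext ξ; ring
    · simp_rw [← fourierInv_laplacian]
      exact integrable_mul_schwartz _ _
    · exact (integrable_mul_schwartz _ _).const_mul _
  constructor
  · rintro rfl φ
    rw [key, integral_mul_eq_fourier]
    refine integral_congr_ae ?_
    rw [fourier_resolvent]
    filter_upwards [mulOp_ae (resolventSymbol τ) (memLp_resolventSymbol hτ) (𝓕 g : L2 d)] with ξ hξ
    rw [hξ, resolventSymbol, mul_inv_cancel_left₀ (symbol_inv_ne_zero hτ ξ)]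
  · intro h
    have hloc : ∀ w : L2 d, LocallyIntegrable w := fun w =>
      (Lp.memLp w).locallyIntegrable (by norm_num)
    have hloc1 : LocallyIntegrable fun ξ : Space d =>
        (Complex.I * (τ : ℂ) - (((2 * Real.pi) ^ 2 * ‖ξ‖ ^ 2 : ℝ) : ℂ)) * (𝓕 u : L2 d) ξ := by
      exact (hloc (𝓕 u)).continuous_smul (continuous_symbol_inv τ)
    have h0 : (fun ξ : Space d => (Complex.I * (τ : ℂ) - (((2 * Real.pi) ^ 2 * ‖ξ‖ ^ 2 : ℝ) : ℂ)) *
        (𝓕 u : L2 d) ξ - (𝓕 g : L2 d) ξ) =ᵐ[volume] 0 := by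
      refine ae_eq_zero_of_integral_schwartz_eq_zero (hloc1.sub (hloc _)) fun ψ => ?_
      have h1 := h (𝓕 ψ)
      rw [key, integral_mul_eq_fourier, FourierTransform.fourierInv_fourier_eq] at h1
      simp_rw [sub_mul _ ((𝓕 g : L2 d) _)]
      rw [integral_sub, h1, sub_self]
      · have h2 := (integrable_mul_schwartz (𝓕 u) (𝓕⁻ (Laplacian.laplacian (𝓕 ψ)))).add
          ((integrable_mul_schwartz (𝓕 u) ψ).const_mul (Complex.I * τ))
        refine h2.congr (ae_of_all _ fun ξ => ?_)
        simp only [Pi.add_apply, fourierInv_laplacian, FourierTransform.fourierInv_fourier_eq]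
        ring
      · exact integrable_mul_schwartz _ _
    apply (Lp.fourierTransformₗᵢ (Space d) ℂ).injective
    change 𝓕 u = 𝓕 (resolvent hτ g)
    rw [fourier_resolvent]
    ext1
    filter_upwards [h0, mulOp_ae (resolventSymbol τ) (memLp_resolventSymbol hτ) (𝓕 g : L2 d)]
      with ξ h1 h2
    rw [h2, ← sub_eq_zero.1 h1, resolventSymbol, inv_mul_cancel_left₀ (symbol_inv_ne_zero hτ ξ)]

/-! ### The Helmholtz equation as a contraction -/

/-- With `q = it + r`, the Helmholtz equation is the fixed point equation
`u = (Δ + i k² t)⁻¹ (-(f + k² r u))`. -/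
theorem isHelmholtzSolution_iff {k t : ℝ} (hτ : 0 < k ^ 2 * t) {q : Space d → ℂ}
    (hq : MemLp q ∞ (volume : Measure (Space d)))
    (hr : MemLp (fun x => q x - Complex.I * t) ∞ (volume : Measure (Space d))) (f u : L2 d) :
    IsHelmholtzSolution k q f u ↔
      u = resolvent hτ (-(f + (k : ℂ) ^ 2 • mulOp (fun x => q x - Complex.I * t) hr u)) := by
  rw [eq_resolvent_iff, IsHelmholtzSolution]
  refine forall_congr' fun φ => ?_
  have hqu : Integrable fun x => q x * u x * φ x := by
    refine (integrable_mul_schwartz (mulOp q hq u) φ).congr ?_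
    filter_upwards [mulOp_ae q hq u] with x hx
    rw [hx]
  have h : ∫ x, (-(f + (k : ℂ) ^ 2 • mulOp (fun x => q x - Complex.I * t) hr u) : L2 d) x * φ x =
      -((∫ x, f x * φ x) + (k : ℂ) ^ 2 * ((∫ x, q x * u x * φ x) -
        Complex.I * t * ∫ x, u x * φ x)) := by
    rw [← integral_const_mul, ← integral_sub hqu, ← integral_const_mul, ← integral_add,
      ← integral_neg]
    · refine integral_congr_ae ?_
      filter_upwards [Lp.coeFn_neg (f + (k : ℂ) ^ 2 • mulOp (fun x => q x - Complex.I * t) hr u),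
        Lp.coeFn_add f ((k : ℂ) ^ 2 • mulOp (fun x => q x - Complex.I * t) hr u),
        Lp.coeFn_smul ((k : ℂ) ^ 2) (mulOp (fun x => q x - Complex.I * t) hr u),
        mulOp_ae (fun x => q x - Complex.I * t) hr u] with x h1 h2 h3 h4
      rw [h1, Pi.neg_apply, h2, Pi.add_apply, h3, Pi.smul_apply, h4, smul_eq_mul]
      ring
    · exact integrable_mul_schwartz f φ
    · exact (hqu.sub ((integrable_mul_schwartz u φ).const_mul _)).const_mul _
    · exact (integrable_mul_schwartz u φ).const_mul _
  rw [h]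
  push_cast
  constructor
  · intro h1
    linear_combination -h1
  · intro h1
    linear_combination -h1

/-- A coefficient `q` all of whose values lie in the disc of radius `θ t` about `i t`. -/
structure IsNearImaginary (t θ : ℝ) (q : Space d → ℂ) : Prop where
  measurable : Measurable q
  norm_sub_le : ∀ x, ‖q x - Complex.I * t‖ ≤ θ * t

namespace IsNearImaginary

variable {t θ : ℝ} {q : Space d → ℂ}

theorem memLp_sub (h : IsNearImaginary t θ q) :
    MemLp (fun x => q x - Complex.I * t) ∞ (volume : Measure (Space d)) :=
  memLp_top_of_measurable_of_bound (h.measurable.sub_const _) h.norm_sub_le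

theorem memLp (h : IsNearImaginary t θ q) : MemLp q ∞ (volume : Measure (Space d)) := by
  refine memLp_top_of_measurable_of_bound (B := θ * t + ‖Complex.I * t‖) h.measurable fun x => ?_
  calc ‖q x‖ = ‖(q x - Complex.I * t) + Complex.I * t‖ := by rw [sub_add_cancel]
    _ ≤ _ := (norm_add_le _ _).trans (by gcongr; exact h.norm_sub_le x)

end IsNearImaginary

/-- The map whose fixed points are the solutions of the Helmholtz equation. -/
noncomputable def helmholtzMap {k t θ : ℝ} (hτ : 0 < k ^ 2 * t) {q : Space d → ℂ}
    (hq : IsNearImaginary t θ q) (f u : L2 d) : L2 d :=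
  resolvent hτ (-(f + (k : ℂ) ^ 2 • mulOp (fun x => q x - Complex.I * t) hq.memLp_sub u))

theorem isHelmholtzSolution_iff_isFixedPt {k t θ : ℝ} (hτ : 0 < k ^ 2 * t) {q : Space d → ℂ}
    (hq : IsNearImaginary t θ q) (f u : L2 d) :
    IsHelmholtzSolution k q f u ↔ Function.IsFixedPt (helmholtzMap hτ hq f) u := by
  rw [isHelmholtzSolution_iff hτ hq.memLp hq.memLp_sub, Function.IsFixedPt, helmholtzMap, eq_comm]

theorem norm_resolvent_mulOp_le {k t θ : ℝ} (hτ : 0 < k ^ 2 * t) {q : Space d → ℂ}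
    (hq : IsNearImaginary t θ q) (u : L2 d) :
    ‖(k : ℂ) ^ 2 • resolvent hτ (mulOp (fun x => q x - Complex.I * t) hq.memLp_sub u)‖ ≤
      θ * ‖u‖ := by
  have hk : k ^ 2 ≠ 0 := left_ne_zero_of_mul hτ.ne'
  have ht : t ≠ 0 := right_ne_zero_of_mul hτ.ne'
  calc _ = k ^ 2 * ‖resolvent hτ (mulOp (fun x => q x - Complex.I * t) hq.memLp_sub u)‖ := by
        rw [norm_smul, norm_pow, Complex.norm_real, Real.norm_eq_abs, sq_abs]
    _ ≤ k ^ 2 * ((k ^ 2 * t)⁻¹ * ((θ * t) * ‖u‖)) := by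
        gcongr
        refine (norm_resolvent_le hτ _).trans ?_
        gcongr
        exact norm_mulOp_le _ hq.norm_sub_le u
    _ = (k ^ 2 * (k ^ 2)⁻¹) * (t * t⁻¹) * (θ * ‖u‖) := by rw [mul_inv]; ring
    _ = θ * ‖u‖ := by rw [mul_inv_cancel₀ hk, mul_inv_cancel₀ ht, one_mul, one_mul]

theorem helmholtzMap_sub {k t θ : ℝ} (hτ : 0 < k ^ 2 * t) {q : Space d → ℂ}
    (hq : IsNearImaginary t θ q) (f u v : L2 d) :
    helmholtzMap hτ hq f u - helmholtzMap hτ hq f v =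
      -((k : ℂ) ^ 2 • resolvent hτ (mulOp (fun x => q x - Complex.I * t) hq.memLp_sub (u - v))) := by
  rw [helmholtzMap, helmholtzMap, ← map_sub (resolvent hτ), ← map_smul (resolvent hτ),
    ← map_neg (resolvent hτ)]
  congr 1
  rw [map_sub, smul_sub]
  abel

theorem contractingWith_helmholtzMap {k t : ℝ} {θ : ℝ≥0} (hτ : 0 < k ^ 2 * t) (hθ : θ < 1)
    {q : Space d → ℂ} (hq : IsNearImaginary t θ q) (f : L2 d) :
    ContractingWith θ (helmholtzMap hτ hq f) := by
  refine ⟨hθ, LipschitzWith.of_dist_le_mul fun u v => ?_⟩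
  rw [dist_eq_norm, dist_eq_norm, helmholtzMap_sub, norm_neg]
  exact norm_resolvent_mulOp_le hτ hq _

theorem existsUnique_isHelmholtzSolution {k t : ℝ} {θ : ℝ≥0} (hτ : 0 < k ^ 2 * t) (hθ : θ < 1)
    {q : Space d → ℂ} (hq : IsNearImaginary t θ q) (f : L2 d) :
    ∃! u, IsHelmholtzSolution k q f u := by
  have h := contractingWith_helmholtzMap hτ hθ hq f
  refine ⟨h.fixedPoint, (isHelmholtzSolution_iff_isFixedPt hτ hq f _).2 h.fixedPoint_isFixedPt,
    fun v hv => h.fixedPoint_unique ((isHelmholtzSolution_iff_isFixedPt hτ hq f _).1 hv)⟩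

/-- Stability of solutions under a change of the coefficient: the error is controlled by the
resolvent of the constant coefficient equation applied to `(q - q') u`. -/
theorem norm_sub_le_norm_resolvent {k t : ℝ} {θ : ℝ≥0} (hτ : 0 < k ^ 2 * t) (hθ : θ < 1)
    {q q' : Space d → ℂ} (hq : IsNearImaginary t θ q) (hq' : IsNearImaginary t θ q')
    (hqq' : MemLp (fun x => q x - q' x) ∞ (volume : Measure (Space d)))
    {f v u : L2 d} (hv : IsHelmholtzSolution k q f v) (hu : IsHelmholtzSolution k q' f u) :
    ‖v - u‖ ≤ k ^ 2 / (1 - θ) * ‖resolvent hτ (mulOp (fun x => q x - q' x) hqq' u)‖ := by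
  rw [isHelmholtzSolution_iff_isFixedPt hτ hq] at hv
  rw [isHelmholtzSolution_iff_isFixedPt hτ hq'] at hu
  have hθ' : 0 < 1 - (θ : ℝ) := sub_pos.2 (by exact_mod_cast hθ)
  have e : mulOp (fun x => q x - q' x) hqq' u =
      mulOp (fun x => q x - Complex.I * t) hq.memLp_sub u -
        mulOp (fun x => q' x - Complex.I * t) hq'.memLp_sub u := by
    ext1
    filter_upwards [mulOp_ae _ hqq' u, mulOp_ae _ hq.memLp_sub u, mulOp_ae _ hq'.memLp_sub u,
      Lp.coeFn_sub (mulOp (fun x => q x - Complex.I * t) hq.memLp_sub u)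
        (mulOp (fun x => q' x - Complex.I * t) hq'.memLp_sub u)] with x h1 h2 h3 h4
    rw [h4, Pi.sub_apply, h1, h2, h3]
    ring
  have h1 : v - u = (helmholtzMap hτ hq f v - helmholtzMap hτ hq f u) -
      (k : ℂ) ^ 2 • resolvent hτ (mulOp (fun x => q x - q' x) hqq' u) := by
    have h2 : helmholtzMap hτ hq f u - helmholtzMap hτ hq' f u =
        -((k : ℂ) ^ 2 • resolvent hτ (mulOp (fun x => q x - q' x) hqq' u)) := by
      rw [e]
      rw [helmholtzMap, helmholtzMap, ← map_sub (resolvent hτ), ← map_smul (resolvent hτ),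
        ← map_neg (resolvent hτ)]
      congr 1
      rw [smul_sub]
      abel
    rw [hv.eq, sub_eq_add_neg _ ((k : ℂ) ^ 2 • _), ← h2, hu.eq]
    abel
  have h3 : ‖v - u‖ ≤ θ * ‖v - u‖ +
      k ^ 2 * ‖resolvent hτ (mulOp (fun x => q x - q' x) hqq' u)‖ := by
    conv_lhs => rw [h1]
    refine (norm_sub_le _ _).trans (add_le_add ?_ ?_)
    · rw [helmholtzMap_sub, norm_neg]
      exact norm_resolvent_mulOp_le hτ hq _
    · rw [norm_smul, norm_pow, Complex.norm_real, Real.norm_eq_abs, sq_abs]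
  rw [div_mul_eq_mul_div, le_div_iff₀ hθ']
  linarith

/-! ### Measurable dependence of the solution on the coefficient -/

/-- In a second countable metric space, measurability can be tested on the distances to points. -/
theorem measurable_of_measurable_dist {Ω X : Type*} [MeasurableSpace Ω] [PseudoMetricSpace X]
    [SecondCountableTopology X] [MeasurableSpace X] [BorelSpace X] {F : Ω → X}
    (hF : ∀ c, Measurable fun ω => dist (F ω) c) : Measurable F := by
  refine measurable_of_isOpen fun U hU => ?_
  obtain ⟨T, hTc, hTS, hTU⟩ := TopologicalSpace.isOpen_sUnion_countable
    {B | ∃ c r, B = Metric.ball c r ∧ Metric.ball c r ⊆ U}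
    (by rintro _ ⟨c, r, rfl, -⟩; exact Metric.isOpen_ball)
  have hU' : U = ⋃₀ T := by
    rw [hTU]
    refine Set.Subset.antisymm (fun x hx => ?_) (Set.sUnion_subset ?_)
    · obtain ⟨r, hr, hrU⟩ := Metric.isOpen_iff.1 hU x hx
      exact ⟨_, ⟨x, r, rfl, hrU⟩, Metric.mem_ball_self hr⟩
    · rintro _ ⟨c, r, rfl, h⟩
      exact h
  rw [hU', Set.preimage_sUnion]
  refine MeasurableSet.biUnion hTc fun B hB => ?_
  obtain ⟨c, r, rfl, -⟩ := hTS hB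
  exact measurableSet_lt (hF c) measurable_const

instance : SecondCountableTopology (L2 d) :=
  haveI : Fact ((2 : ℝ≥0∞) ≠ ∞) := ⟨ENNReal.ofNat_ne_top⟩
  Lp.SecondCountableTopology

/-- A jointly measurable function whose sections are in `L²` defines a measurable `L²`-valued
map. -/
theorem stronglyMeasurable_of_uncurry {Ω : Type*} [MeasurableSpace Ω] {F : Ω → L2 d}
    {h : Ω → Space d → ℂ} (hh : Measurable (Function.uncurry h))
    (hF : ∀ ω, F ω =ᵐ[volume] h ω) : StronglyMeasurable F := by
  borelize (L2 d)
  refine Measurable.stronglyMeasurable (measurable_of_measurable_dist fun c => ?_)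
  have e : ∀ ω, dist (F ω) c = ((∫⁻ x, ‖h ω x - c x‖ₑ ^ (2:ℝ)) ^ (1 / (2:ℝ))).toReal := by
    intro ω
    rw [_root_.dist_eq_norm, Lp.norm_def, eLpNorm_eq_lintegral_rpow_enorm_toReal (by norm_num) (by norm_num)]
    congr 2
    simp only [ENNReal.toReal_ofNat]
    refine lintegral_congr_ae ?_
    filter_upwards [Lp.coeFn_sub (F ω) c, hF ω] with x h1 h2
    rw [h1, Pi.sub_apply, h2]
  simp_rw [e]
  refine (Measurable.pow_const (Measurable.lintegral_prod_right' (f := fun p : Ω × Space d =>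
    ‖h p.1 p.2 - c p.2‖ₑ ^ (2:ℝ)) ?_) _).ennreal_toReal
  exact ((hh.sub ((Lp.stronglyMeasurable c).measurable.comp measurable_snd)).enorm).pow_const _

/-- The fixed point of a measurable family of contractions is measurable, as the limit of the
iterates of a constant map. -/
theorem stronglyMeasurable_of_isFixedPt {Ω X : Type*} [MeasurableSpace Ω] [MetricSpace X]
    [SecondCountableTopology X] [CompleteSpace X] [Nonempty X] {θ : ℝ≥0} {Φ : Ω → X → X}
    (hΦ : ∀ ω, ContractingWith θ (Φ ω)) (hm : ∀ x, StronglyMeasurable fun ω => Φ ω x)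
    {v : Ω → X} (hv : ∀ ω, Function.IsFixedPt (Φ ω) (v ω)) : StronglyMeasurable v := by
  borelize X
  obtain ⟨x₀⟩ := ‹Nonempty X›
  have hjoint := stronglyMeasurable_uncurry_of_continuous_of_stronglyMeasurable
    (u := fun x ω => Φ ω x) (fun ω => (hΦ ω).toLipschitzWith.continuous) hm
  have hiter : ∀ n : ℕ, StronglyMeasurable fun ω => (Φ ω)^[n] x₀ := by
    intro n
    induction n with
    | zero => exact stronglyMeasurable_const
    | succ n ih =>
      simp_rw [Function.iterate_succ_apply']
      exact hjoint.comp_measurable (ih.measurable.prodMk measurable_id)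
  have : Nonempty X := ⟨x₀⟩
  refine stronglyMeasurable_of_tendsto atTop hiter (tendsto_pi_nhds.2 fun ω => ?_)
  rw [(hΦ ω).fixedPoint_unique (hv ω)]
  exact (hΦ ω).tendsto_iterate_fixedPoint x₀

/-- Solutions depend measurably on a random coefficient. -/
theorem stronglyMeasurable_of_isHelmholtzSolution {Ω : Type*} [MeasurableSpace Ω] {k t : ℝ}
    {θ : ℝ≥0} (hτ : 0 < k ^ 2 * t) (hθ : θ < 1) {q : Ω → Space d → ℂ}
    (hqm : Measurable (Function.uncurry q)) (hq : ∀ ω, IsNearImaginary t θ (q ω)) (f : L2 d)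
    {v : Ω → L2 d} (hv : ∀ ω, IsHelmholtzSolution k (q ω) f (v ω)) : StronglyMeasurable v := by
  have hmul : ∀ u : L2 d, StronglyMeasurable fun ω =>
      mulOp (fun x => q ω x - Complex.I * t) (hq ω).memLp_sub u := fun u =>
    stronglyMeasurable_of_uncurry (h := fun ω x => (q ω x - Complex.I * t) * u x)
      ((hqm.sub_const _).mul ((Lp.stronglyMeasurable u).measurable.comp measurable_snd))
      fun ω => mulOp_ae _ _ _
  have hcont : Continuous fun w : L2 d => resolvent hτ (-(f + (k : ℂ) ^ 2 • w)) :=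
    (resolvent hτ).continuous.comp (continuous_const.add (continuous_const_smul _)).neg
  exact stronglyMeasurable_of_isFixedPt
    (fun ω => contractingWith_helmholtzMap hτ hθ (hq ω) f)
    (fun u => hcont.comp_stronglyMeasurable (hmul u))
    (fun ω => (isHelmholtzSolution_iff_isFixedPt hτ (hq ω) f _).1 (hv ω))

/-! ### The Fourier transform on `L¹ ∩ L²` -/

theorem continuous_fourier_of_integrable {g : Space d → ℂ} (hg : Integrable g) :
    Continuous (𝓕 g : Space d → ℂ) :=
  VectorFourier.fourierIntegral_continuous Real.continuous_fourierChar
    (innerSL ℝ).continuous₂ hg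

/-- On `L¹ ∩ L²` the Fourier transform of `L²` is given by the Fourier integral. -/
theorem fourier_ae_eq_of_integrable (g : L2 d) {g₀ : Space d → ℂ} (hg : g =ᵐ[volume] g₀)
    (hg₀ : Integrable g₀) : (𝓕 g : L2 d) =ᵐ[volume] (𝓕 g₀ : Space d → ℂ) := by
  have h1 : LocallyIntegrable (𝓕 g : L2 d) volume :=
    (Lp.memLp (𝓕 g : L2 d)).locallyIntegrable (by norm_num)
  have h2 : LocallyIntegrable (𝓕 g₀ : Space d → ℂ) volume :=
    (continuous_fourier_of_integrable hg₀).locallyIntegrable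
  have h := ae_eq_zero_of_integral_schwartz_eq_zero (h1.sub h2) fun φ => by
    have e1 : ∫ ξ, (𝓕 g₀ : Space d → ℂ) ξ * φ ξ = ∫ x, g₀ x * (𝓕 φ : 𝓢(Space d, ℂ)) x := by
      simpa using! VectorFourier.integral_bilin_fourierIntegral_eq_flip (ContinuousLinearMap.mul ℂ ℂ)
        (L := innerₗ (Space d)) Real.continuous_fourierChar continuous_inner hg₀ φ.integrable
    have e2 : ∫ x, g x * (𝓕 φ : 𝓢(Space d, ℂ)) x = ∫ x, g₀ x * (𝓕 φ : 𝓢(Space d, ℂ)) x := by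
      refine integral_congr_ae ?_
      filter_upwards [hg] with x hx
      rw [hx]
    simp only [Pi.sub_apply, sub_mul]
    rw [integral_sub, integral_fourier_mul, e1, e2, sub_self]
    · exact integrable_mul_schwartz _ _
    · refine φ.integrable.bdd_mul (c := ∫ x, ‖g₀ x‖)
        (continuous_fourier_of_integrable hg₀).aestronglyMeasurable (ae_of_all _ fun ξ => ?_)
      rw [Real.fourier_eq]
      refine (norm_integral_le_integral_norm _).trans_eq ?_
      simp_rw [Circle.norm_smul]
  filter_upwards [h] with ξ hξ
  exact sub_eq_zero.1 hξ

theorem enorm_sq_eq_lintegral (g : L2 d) : ‖g‖ₑ ^ 2 = ∫⁻ x, ‖g x‖ₑ ^ 2 := by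
  have h := eLpNorm_nnreal_pow_eq_lintegral (f := (g : Space d → ℂ)) (μ := volume)
    (p := 2) two_ne_zero
  rw [Lp.enorm_def]
  simpa using h

theorem enorm_resolvent_sq {τ : ℝ} (hτ : 0 < τ) {g : L2 d} {g₀ : Space d → ℂ}
    (hg : g =ᵐ[volume] g₀) (hg₀ : Integrable g₀) :
    ‖resolvent hτ g‖ₑ ^ 2 =
      ∫⁻ ξ, ‖resolventSymbol τ ξ‖ₑ ^ 2 * ‖(𝓕 g₀ : Space d → ℂ) ξ‖ₑ ^ 2 := by
  rw [← ofReal_norm, ← Lp.norm_fourier_eq, fourier_resolvent, ofReal_norm, enorm_sq_eq_lintegral]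
  refine lintegral_congr_ae ?_
  filter_upwards [mulOp_ae (resolventSymbol τ) (memLp_resolventSymbol hτ) (𝓕 g : L2 d),
    fourier_ae_eq_of_integrable g hg hg₀] with ξ h2 h3
  rw [h2, h3, enorm_mul, mul_pow]

theorem fourier_mul_eq (φ : 𝓢(Space d, ℂ)) (z : Space d → ℂ) (ξ : Space d) :
    𝓕 (fun x => z x * φ x) ξ =
      ∫ x, z x * ((Real.fourierChar (-inner ℝ x ξ) : ℂ) * φ x) := by
  simp only [Real.fourier_eq, Circle.smul_def, smul_eq_mul]
  congr 1; ext x; ring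

theorem measurable_fourierChar_mul {X : Type*} [MeasurableSpace X] (φ : 𝓢(Space d, ℂ))
    {f g : X → Space d} (hf : Measurable f) (hg : Measurable g) :
    Measurable fun x => (Real.fourierChar (-inner ℝ (f x) (g x)) : ℂ) * φ (f x) := by
  have h : Continuous fun s : ℝ => (Real.fourierChar s : ℂ) :=
    continuous_subtype_val.comp Real.continuous_fourierChar
  exact (h.measurable.comp (hf.inner hg).neg).mul (φ.continuous.measurable.comp hf)

theorem mulOp_ae_of_ae_eq {q g₀ : Space d → ℂ} (hq : MemLp q ∞ (volume : Measure (Space d)))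
    {w : L2 d} (hw : w =ᵐ[volume] g₀) : mulOp q hq w =ᵐ[volume] fun x => q x * g₀ x := by
  filter_upwards [mulOp_ae q hq w, hw] with x h1 h2
  rw [h1, h2]

/-! ### Random fields with finite range of dependence -/

/-- Near the diagonal, `|b(y)| |b(z)| ≤ |b(y)|² + |b(z)|²` replaces the Cauchy-Schwarz inequality,
and integrating out the other variable gives the volume of a ball. -/
theorem lintegral_near_diagonal_le {b : Space d → ℂ} (hb : Measurable b) (R : ℝ) :
    ∫⁻ p, {p : Space d × Space d | dist p.1 p.2 < R}.indicator
        (fun p => ‖b p.1‖ₑ * ‖b p.2‖ₑ) p ∂(volume.prod volume) ≤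
      2 * volume (Metric.ball (0 : Space d) R) * ∫⁻ x, ‖b x‖ₑ ^ 2 := by
  have hS : MeasurableSet {p : Space d × Space d | dist p.1 p.2 < R} :=
    measurableSet_lt measurable_dist measurable_const
  have hm1 : Measurable ({p : Space d × Space d | dist p.1 p.2 < R}.indicator
      fun p => ‖b p.1‖ₑ ^ 2) := ((hb.comp measurable_fst).enorm.pow_const 2).indicator hS
  have hm2 : Measurable ({p : Space d × Space d | dist p.1 p.2 < R}.indicator
      fun p => ‖b p.2‖ₑ ^ 2) := ((hb.comp measurable_snd).enorm.pow_const 2).indicator hS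
  have hball : ∀ x : Space d, volume (Metric.ball x R) = volume (Metric.ball (0 : Space d) R) :=
    fun x => by rw [Measure.addHaar_ball_center]
  have h1 : ∫⁻ p, {p : Space d × Space d | dist p.1 p.2 < R}.indicator
      (fun p => ‖b p.1‖ₑ ^ 2) p ∂(volume.prod volume) =
        volume (Metric.ball (0 : Space d) R) * ∫⁻ x, ‖b x‖ₑ ^ 2 := by
    rw [lintegral_prod _ hm1.aemeasurable, ← lintegral_const_mul _ (hb.enorm.pow_const 2)]
    refine lintegral_congr fun x => ?_
    have : (fun y => {p : Space d × Space d | dist p.1 p.2 < R}.indicator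
        (fun p => ‖b p.1‖ₑ ^ 2) (x, y)) = (Metric.ball x R).indicator fun _ => ‖b x‖ₑ ^ 2 := by
      ext y
      simp only [Set.indicator, Set.mem_ofPred_eq, Metric.mem_ball, dist_comm]
    rw [this, lintegral_indicator_const Metric.isOpen_ball.measurableSet, hball, mul_comm]
  have h2 : ∫⁻ p, {p : Space d × Space d | dist p.1 p.2 < R}.indicator
      (fun p => ‖b p.2‖ₑ ^ 2) p ∂(volume.prod volume) =
        volume (Metric.ball (0 : Space d) R) * ∫⁻ x, ‖b x‖ₑ ^ 2 := by
    rw [lintegral_prod_symm _ hm2.aemeasurable, ← lintegral_const_mul _ (hb.enorm.pow_const 2)]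
    refine lintegral_congr fun x => ?_
    have : (fun y => {p : Space d × Space d | dist p.1 p.2 < R}.indicator
        (fun p => ‖b p.2‖ₑ ^ 2) (y, x)) = (Metric.ball x R).indicator fun _ => ‖b x‖ₑ ^ 2 := by
      ext y
      simp only [Set.indicator, Set.mem_ofPred_eq, Metric.mem_ball]
    rw [this, lintegral_indicator_const Metric.isOpen_ball.measurableSet, hball, mul_comm]
  calc _ ≤ ∫⁻ p, ({p : Space d × Space d | dist p.1 p.2 < R}.indicator (fun p => ‖b p.1‖ₑ ^ 2) p +
        {p : Space d × Space d | dist p.1 p.2 < R}.indicator (fun p => ‖b p.2‖ₑ ^ 2) p)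
          ∂(volume.prod volume) := by
        refine lintegral_mono fun p => ?_
        simp only [Set.indicator]
        split_ifs
        · rcases le_total ‖b p.1‖ₑ ‖b p.2‖ₑ with h | h
          · calc ‖b p.1‖ₑ * ‖b p.2‖ₑ ≤ ‖b p.2‖ₑ * ‖b p.2‖ₑ := by gcongr
              _ = ‖b p.2‖ₑ ^ 2 := (sq _).symm
              _ ≤ _ := le_add_self
          · calc ‖b p.1‖ₑ * ‖b p.2‖ₑ ≤ ‖b p.1‖ₑ * ‖b p.1‖ₑ := by gcongr
              _ = ‖b p.1‖ₑ ^ 2 := (sq _).symm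
              _ ≤ _ := le_self_add
        · simp
    _ = _ := by rw [lintegral_add_left hm1, h1, h2]; ring

/-- A random field bounded by one whose values at distance at least `R` are uncorrelated. -/
structure IsShortRange {Ω : Type*} [MeasurableSpace Ω] (P : Measure Ω) (R : ℝ)
    (Z : Ω → Space d → ℂ) : Prop where
  measurable : Measurable (Function.uncurry Z)
  norm_le_one : ∀ ω x, ‖Z ω x‖ ≤ 1
  uncorrelated : ∀ y z, R ≤ dist y z → ∫ ω, Z ω y * (starRingEnd ℂ) (Z ω z) ∂P = 0

namespace IsShortRange

variable {Ω : Type*} [MeasurableSpace Ω] {P : Measure Ω} {R : ℝ}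
  {Z : Ω → Space d → ℂ}

theorem measurable_section (hZ : IsShortRange P R Z) (ω : Ω) : Measurable (Z ω) :=
  hZ.measurable.comp measurable_prodMk_left

theorem memLp (hZ : IsShortRange P R Z) (ω : Ω) :
    MemLp (Z ω) ∞ (volume : Measure (Space d)) :=
  memLp_top_of_measurable_of_bound (hZ.measurable_section ω) (hZ.norm_le_one ω)

/-- The second moment of `∫ Z b` only sees pairs of points at distance less than `R`. -/
theorem lintegral_enorm_integral_sq_le [IsProbabilityMeasure P] (hZ : IsShortRange P R Z) {b : Space d → ℂ}
    (hb : Measurable b) (hbi : Integrable b) :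
    ∫⁻ ω, ‖∫ x, Z ω x * b x‖ₑ ^ 2 ∂P ≤
      2 * volume (Metric.ball (0 : Space d) R) * ∫⁻ x, ‖b x‖ₑ ^ 2 := by
  set a : Ω → ℂ := fun ω => ∫ x, Z ω x * b x with ha
  have ham : StronglyMeasurable a :=
    StronglyMeasurable.integral_prod_right'
      (f := fun p : Ω × Space d => Z p.1 p.2 * b p.2)
      (hZ.measurable.mul (hb.comp measurable_snd)).stronglyMeasurable
  have hab : ∀ ω, ‖a ω‖ ≤ ∫ x, ‖b x‖ := fun ω => by
    refine (norm_integral_le_integral_norm _).trans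
      (integral_mono_of_nonneg (ae_of_all _ fun x => norm_nonneg _) hbi.norm
        (ae_of_all _ fun x => ?_))
    simp only [norm_mul]
    exact mul_le_of_le_one_left (norm_nonneg _) (hZ.norm_le_one ω x)
  have hai : Integrable (fun ω => ‖a ω‖ ^ 2) P := by
    refine Integrable.of_bound (ham.norm.pow 2).aestronglyMeasurable ((∫ x, ‖b x‖) ^ 2)
      (ae_of_all _ fun ω => ?_)
    rw [Real.norm_of_nonneg (by positivity)]
    gcongr
    exact hab ω
  let G : Ω → Space d × Space d → ℂ := fun ω p =>
    (Z ω p.1 * b p.1) * (starRingEnd ℂ) (Z ω p.2 * b p.2)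
  have hGm : Measurable (Function.uncurry G) := by
    have h1 : Measurable fun q : Ω × Space d × Space d => Z q.1 q.2.1 * b q.2.1 :=
      (hZ.measurable.comp (measurable_fst.prodMk (measurable_fst.comp measurable_snd))).mul
        (hb.comp (measurable_fst.comp measurable_snd))
    have h2 : Measurable fun q : Ω × Space d × Space d => Z q.1 q.2.2 * b q.2.2 :=
      (hZ.measurable.comp (measurable_fst.prodMk (measurable_snd.comp measurable_snd))).mul
        (hb.comp (measurable_snd.comp measurable_snd))
    exact h1.mul (Complex.continuous_conj.measurable.comp h2)
  have hGi : Integrable (Function.uncurry G) (P.prod (volume.prod volume)) := by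
    have h : Integrable (fun q : Ω × Space d × Space d => (1 : ℝ) * (‖b q.2.1‖ * ‖b q.2.2‖))
        (P.prod (volume.prod volume)) :=
      (integrable_const (1 : ℝ)).mul_prod (hbi.norm.mul_prod hbi.norm)
    refine h.mono' hGm.aestronglyMeasurable (ae_of_all _ fun q => ?_)
    simp only [Function.uncurry, G, norm_mul, RCLike.norm_conj, one_mul]
    gcongr
    · exact mul_le_of_le_one_left (norm_nonneg _) (hZ.norm_le_one _ _)
    · exact mul_le_of_le_one_left (norm_nonneg _) (hZ.norm_le_one _ _)
  have hGa : ∀ ω, ∫ p, G ω p ∂(volume.prod volume) = ((‖a ω‖ ^ 2 : ℝ) : ℂ) := fun ω => by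
    simp only [G]
    rw [integral_prod_mul (fun x => Z ω x * b x) fun x => (starRingEnd ℂ) (Z ω x * b x),
      integral_conj, Complex.mul_conj, Complex.normSq_eq_norm_sq]
  have hkey : ∫⁻ ω, ‖a ω‖ₑ ^ 2 ∂P = ‖∫ p, ∫ ω, G ω p ∂P ∂(volume.prod volume)‖ₑ := by
    rw [← integral_integral_swap hGi]
    simp_rw [hGa]
    rw [integral_complex_ofReal, ← ofReal_norm, Complex.norm_real, Real.norm_of_nonneg
      (integral_nonneg fun ω => by positivity), ofReal_integral_eq_lintegral_ofReal hai
      (ae_of_all _ fun ω => by positivity)]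
    refine lintegral_congr fun ω => ?_
    rw [ENNReal.ofReal_pow (norm_nonneg _), ofReal_norm]
  rw [hkey]
  refine (enorm_integral_le_lintegral_enorm _).trans
    ((lintegral_mono fun p => ?_).trans (lintegral_near_diagonal_le hb R))
  have hGp : ∫ ω, G ω p ∂P = (b p.1 * (starRingEnd ℂ) (b p.2)) *
      ∫ ω, Z ω p.1 * (starRingEnd ℂ) (Z ω p.2) ∂P := by
    rw [← integral_const_mul]
    refine integral_congr_ae (ae_of_all _ fun ω => ?_)
    simp only [G, map_mul]
    ring
  simp only [Set.indicator, Set.mem_ofPred_eq]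
  split_ifs with h
  · rw [hGp, enorm_mul, enorm_mul, RCLike.enorm_conj]
    refine mul_le_of_le_one_right' ?_
    refine (enorm_integral_le_lintegral_enorm _).trans ?_
    calc _ ≤ ∫⁻ _, 1 ∂P := lintegral_mono fun ω => by
          rw [enorm_mul, RCLike.enorm_conj]
          refine mul_le_one' ?_ ?_ <;>
          · rw [← ofReal_norm]
            exact ENNReal.ofReal_le_one.2 (hZ.norm_le_one _ _)
      _ = 1 := by simp
  · rw [hGp, hZ.uncorrelated _ _ (not_lt.1 h)]
    simp

theorem stronglyMeasurable_mulOp (hZ : IsShortRange P R Z) (u : L2 d) :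
    StronglyMeasurable fun ω => mulOp (Z ω) (hZ.memLp ω) u :=
  stronglyMeasurable_of_uncurry (h := fun ω x => Z ω x * u x)
    (hZ.measurable.mul ((Lp.stronglyMeasurable u).measurable.comp measurable_snd))
    fun _ => mulOp_ae _ _ _

theorem stronglyMeasurable_resolvent_mulOp (hZ : IsShortRange P R Z) {τ : ℝ} (hτ : 0 < τ)
    (u : L2 d) : StronglyMeasurable fun ω => resolvent hτ (mulOp (Z ω) (hZ.memLp ω) u) :=
  (resolvent hτ).continuous.comp_stronglyMeasurable (hZ.stronglyMeasurable_mulOp u)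

theorem norm_resolvent_mulOp_le (hZ : IsShortRange P R Z) {τ : ℝ} (hτ : 0 < τ) (u : L2 d) (ω : Ω) :
    ‖resolvent hτ (mulOp (Z ω) (hZ.memLp ω) u)‖ ≤ τ⁻¹ * ‖u‖ := by
  refine (norm_resolvent_le hτ _).trans ?_
  gcongr
  simpa using norm_mulOp_le (hZ.memLp ω) (hZ.norm_le_one ω) u

theorem integrable_norm_resolvent_mulOp_sq [IsProbabilityMeasure P] (hZ : IsShortRange P R Z)
    {τ : ℝ} (hτ : 0 < τ) (u : L2 d) :
    Integrable (fun ω => ‖resolvent hτ (mulOp (Z ω) (hZ.memLp ω) u)‖ ^ 2) P := by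
  refine Integrable.of_bound
    ((hZ.stronglyMeasurable_resolvent_mulOp hτ u).norm.pow 2).aestronglyMeasurable
    ((τ⁻¹ * ‖u‖) ^ 2) (ae_of_all _ fun ω => ?_)
  rw [Real.norm_of_nonneg (by positivity)]
  gcongr
  exact hZ.norm_resolvent_mulOp_le hτ u ω

theorem measurable_fourier_mul (hZ : IsShortRange P R Z) (φ : 𝓢(Space d, ℂ)) :
    Measurable fun q : Ω × Space d => 𝓕 (fun x => Z q.1 x * φ x) q.2 := by
  have h1 : Measurable fun q : (Ω × Space d) × Space d => Z q.1.1 q.2 :=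
    hZ.measurable.comp ((measurable_fst.comp measurable_fst).prodMk measurable_snd)
  have h2 : Measurable fun q : (Ω × Space d) × Space d =>
      (Real.fourierChar (-inner ℝ q.2 q.1.2) : ℂ) * φ q.2 :=
    measurable_fourierChar_mul φ measurable_snd (measurable_snd.comp measurable_fst)
  have h3 : StronglyMeasurable fun q : Ω × Space d =>
      ∫ x, Z q.1 x * ((Real.fourierChar (-inner ℝ x q.2) : ℂ) * φ x) :=
    (h1.mul h2).stronglyMeasurable.integral_prod_right'
  have e : (fun q : Ω × Space d => 𝓕 (fun x => Z q.1 x * φ x) q.2) = fun q : Ω × Space d =>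
      ∫ x, Z q.1 x * ((Real.fourierChar (-inner ℝ x q.2) : ℂ) * φ x) :=
    funext fun q => fourier_mul_eq φ (Z q.1) q.2
  rw [e]
  exact h3.measurable

/-- Every single frequency of `Z φ` has a small second moment. -/
theorem lintegral_fourier_sq_le [IsProbabilityMeasure P] (hZ : IsShortRange P R Z)
    (φ : 𝓢(Space d, ℂ)) {w : L2 d} (hw : w =ᵐ[volume] φ) (ξ : Space d) :
    ∫⁻ ω, ‖𝓕 (fun x => Z ω x * φ x) ξ‖ₑ ^ 2 ∂P ≤
      2 * volume (Metric.ball (0 : Space d) R) *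
        ‖w‖ₑ ^ 2 := by
  have hφ : ‖w‖ₑ ^ 2 = ∫⁻ x, ‖φ x‖ₑ ^ 2 := by
    rw [enorm_sq_eq_lintegral]
    refine lintegral_congr_ae ?_
    filter_upwards [hw] with x hx
    rw [hx]
  have hb : Measurable fun x => (Real.fourierChar (-inner ℝ x ξ) : ℂ) * φ x :=
    measurable_fourierChar_mul φ measurable_id measurable_const
  have hn : ∀ x, ‖(Real.fourierChar (-inner ℝ x ξ) : ℂ) * φ x‖ = ‖φ x‖ := fun x => by
    rw [norm_mul, Circle.norm_coe, one_mul]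
  simp_rw [fourier_mul_eq]
  refine (hZ.lintegral_enorm_integral_sq_le hb
    (φ.integrable.congr' hb.aestronglyMeasurable (ae_of_all _ fun x => (hn x).symm))).trans_eq ?_
  rw [hφ]
  simp_rw [← ofReal_norm, hn]

theorem lintegral_resolvent_schwartz_sq_le [IsProbabilityMeasure P] (hZ : IsShortRange P R Z)
    {τ : ℝ} (hτ : 0 < τ) (φ : 𝓢(Space d, ℂ)) {w : L2 d}
    (hw : w =ᵐ[volume] φ) :
    ∫⁻ ω, ‖resolvent hτ (mulOp (Z ω) (hZ.memLp ω) w)‖ₑ ^ 2 ∂P ≤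
      (∫⁻ ξ : Space d, ‖resolventSymbol τ ξ‖ₑ ^ 2) *
        (2 * volume (Metric.ball (0 : Space d) R) *
          ‖w‖ₑ ^ 2) := by
  have hnorm : ∀ ω, ‖resolvent hτ (mulOp (Z ω) (hZ.memLp ω) w)‖ₑ ^ 2 =
      ∫⁻ ξ, ‖resolventSymbol τ ξ‖ₑ ^ 2 * ‖𝓕 (fun x => Z ω x * φ x) ξ‖ₑ ^ 2 := fun ω => by
    exact enorm_resolvent_sq hτ (mulOp_ae_of_ae_eq (hZ.memLp ω) hw) (φ.integrable.bdd_mul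
      (hZ.measurable_section ω).aestronglyMeasurable (ae_of_all _ (hZ.norm_le_one ω)))
  have hsym : Measurable fun ξ : Space d => ‖resolventSymbol τ ξ‖ₑ ^ 2 :=
    (measurable_resolventSymbol τ).enorm.pow_const 2
  have hFm := hZ.measurable_fourier_mul φ
  have hFi := hZ.lintegral_fourier_sq_le φ hw
  simp_rw [hnorm]
  generalize hF : (fun (ω : Ω) (ξ : Space d) => 𝓕 (fun x => Z ω x * φ x) ξ) = F
  have hF' : ∀ ω ξ, 𝓕 (fun x => Z ω x * φ x) ξ = F ω ξ := fun ω ξ => by rw [← hF]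
  simp_rw [hF'] at hFm hFi ⊢
  have hF2 : Measurable fun q : Ω × Space d => ‖F q.1 q.2‖ₑ ^ 2 := hFm.enorm.pow_const 2
  rw [lintegral_lintegral_swap ((hsym.comp measurable_snd).mul hF2).aemeasurable,
    ← lintegral_mul_const _ hsym]
  refine lintegral_mono fun ξ => ?_
  have hFξ : Measurable fun ω => ‖F ω ξ‖ₑ ^ 2 := hF2.comp measurable_prodMk_right
  rw [lintegral_const_mul _ hFξ]
  gcongr
  exact hFi ξ

/-- The resolvent of a constant coefficient Helmholtz operator averages out a short range field:
the mean square of `(Δ + iτ)⁻¹ (Z u)` is of the order of the volume of a correlation ball. -/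
theorem integral_norm_resolvent_sq_le [IsProbabilityMeasure P] (hZ : IsShortRange P R Z)
    {τ : ℝ} (hτ : 0 < τ) (hd : d < 4) (u : L2 d) :
    ∫ ω, ‖resolvent hτ (mulOp (Z ω) (hZ.memLp ω) u)‖ ^ 2 ∂P ≤
      4 * (∫ ξ : Space d, ‖resolventSymbol τ ξ‖ ^ 2) *
        (volume (Metric.ball (0 : Space d) R)).toReal * ‖u‖ ^ 2 := by
  set A := ∫ ξ : Space d, ‖resolventSymbol τ ξ‖ ^ 2 with hA
  set W := (volume (Metric.ball (0 : Space d) R)).toReal with hW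
  have hA' : ∫⁻ ξ : Space d, ‖resolventSymbol τ ξ‖ₑ ^ 2 = ENNReal.ofReal A := by
    rw [hA, ofReal_integral_eq_lintegral_ofReal (integrable_norm_resolventSymbol_sq hτ hd)
      (ae_of_all _ fun ξ => by positivity)]
    refine lintegral_congr fun ξ => ?_
    rw [ENNReal.ofReal_pow (norm_nonneg _), ofReal_norm]
  have hA0 : 0 ≤ A := integral_nonneg fun ξ => by positivity
  have hW0 : 0 ≤ W := ENNReal.toReal_nonneg
  have hschwartz : ∀ (φ : 𝓢(Space d, ℂ)) (w : L2 d), w =ᵐ[volume] φ →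
      ∫ ω, ‖resolvent hτ (mulOp (Z ω) (hZ.memLp ω) w)‖ ^ 2 ∂P ≤
        2 * A * W * ‖w‖ ^ 2 := fun φ w hw => by
    have h := hZ.lintegral_resolvent_schwartz_sq_le hτ φ hw
    have h2W : 2 * ENNReal.ofReal W = ENNReal.ofReal (2 * W) := by
      rw [ENNReal.ofReal_mul zero_le_two, ENNReal.ofReal_ofNat]
    rw [hA', ← ENNReal.ofReal_toReal (measure_ball_lt_top (x := (0 : Space d)) (r := R)).ne, ← hW,
      ← ofReal_norm, ← ENNReal.ofReal_pow (norm_nonneg _), h2W, ← ENNReal.ofReal_mul (by positivity),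
      ← ENNReal.ofReal_mul hA0] at h
    rw [integral_eq_lintegral_of_nonneg_ae (ae_of_all _ fun ω => by positivity)
      (hZ.integrable_norm_resolvent_mulOp_sq hτ _).aestronglyMeasurable]
    refine ENNReal.toReal_le_of_le_ofReal (by positivity) ?_
    convert h using 1
    · refine lintegral_congr fun ω => ?_
      rw [ENNReal.ofReal_pow (norm_nonneg _), ofReal_norm]
    · congr 1; ring
  -- The bound with an error `‖u - w‖²` holds for `w` in the dense set of Schwartz functions,
  -- hence also for `w = u`.
  have happrox : ∀ w : L2 d, ∫ ω, ‖resolvent hτ (mulOp (Z ω) (hZ.memLp ω) u)‖ ^ 2 ∂P ≤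
      4 * A * W * ‖w‖ ^ 2 + 2 * (τ⁻¹ * ‖u - w‖) ^ 2 := fun w₀ => by
    refine DenseRange.induction_on (p := fun w : L2 d =>
      ∫ ω, ‖resolvent hτ (mulOp (Z ω) (hZ.memLp ω) u)‖ ^ 2 ∂P ≤
        4 * A * W * ‖w‖ ^ 2 + 2 * (τ⁻¹ * ‖u - w‖) ^ 2)
      (SchwartzMap.denseRange_toLpCLM (p := 2) ENNReal.ofNat_ne_top) w₀
      (isClosed_le continuous_const (by fun_prop)) fun φ => ?_
    rw [SchwartzMap.toLpCLM_apply]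
    have hs := hschwartz φ _ (φ.coeFn_toLp 2 volume)
    generalize φ.toLp 2 (volume : Measure (Space d)) = w at hs ⊢
    have h1 : ∀ ω, ‖resolvent hτ (mulOp (Z ω) (hZ.memLp ω) u)‖ ^ 2 ≤
        2 * ‖resolvent hτ (mulOp (Z ω) (hZ.memLp ω) w)‖ ^ 2 +
          2 * (τ⁻¹ * ‖u - w‖) ^ 2 := fun ω => by
      have h2 := hZ.norm_resolvent_mulOp_le hτ (u - w) ω
      have h3 : ‖resolvent hτ (mulOp (Z ω) (hZ.memLp ω) u)‖ ≤
          ‖resolvent hτ (mulOp (Z ω) (hZ.memLp ω) w)‖ + τ⁻¹ * ‖u - w‖ := by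
        refine le_trans ?_ (add_le_add_right h2 _)
        rw [map_sub, map_sub]
        exact norm_le_norm_add_norm_sub' _ _
      refine (pow_le_pow_left₀ (norm_nonneg _) h3 2).trans ?_
      nlinarith [sq_nonneg (‖resolvent hτ (mulOp (Z ω) (hZ.memLp ω) w)‖ -
        τ⁻¹ * ‖u - w‖)]
    have hi := (hZ.integrable_norm_resolvent_mulOp_sq hτ w).const_mul 2
    refine (integral_mono (hZ.integrable_norm_resolvent_mulOp_sq hτ u)
      (hi.add (integrable_const _)) h1).trans ?_
    rw [integral_add' hi (integrable_const _), integral_const_mul]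
    simp only [integral_const, probReal_univ, one_smul]
    linarith
  simpa using happrox u

end IsShortRange

/-! ### The cloud of balls around a Poisson process -/

open Classical in
/-- The indicator function of the `ε`-neighbourhood of `S`. -/
noncomputable def cloudIndicator (ε : ℝ) (S : Set (Space d)) (x : Space d) : ℝ :=
  if Metric.infEDist x S < ENNReal.ofReal ε then 1 else 0

theorem cloudIndex_eq (n₀ n₁ : ℂ) (ε : ℝ) (S : Set (Space d)) (x : Space d) :
    cloudIndex n₀ n₁ ε S x = n₀ + (n₁ - n₀) * (cloudIndicator ε S x : ℂ) := by
  unfold cloudIndex cloudIndicator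
  split_ifs <;> simp

theorem cloudIndicator_nonneg (ε : ℝ) (S : Set (Space d)) (x : Space d) :
    0 ≤ cloudIndicator ε S x := by
  unfold cloudIndicator
  split_ifs <;> simp

theorem cloudIndicator_le_one (ε : ℝ) (S : Set (Space d)) (x : Space d) :
    cloudIndicator ε S x ≤ 1 := by
  unfold cloudIndicator
  split_ifs <;> simp

theorem infEDist_lt_iff_pointCount {Ω : Type*} (S : Ω → Set (Space d)) (x : Space d) (r : ℝ≥0∞)
    (ω : Ω) : Metric.infEDist x (S ω) < r ↔ pointCount S (Metric.eball x r) ω ≠ 0 := by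
  rw [Metric.infEDist_lt_iff, pointCount, Set.encard_ne_zero]
  simp only [Set.Nonempty, Set.mem_inter_iff, Metric.mem_eball, edist_comm]

theorem cloudIndicator_eq_pointCount {Ω : Type*} (ε : ℝ) (S : Ω → Set (Space d)) (x : Space d)
    (ω : Ω) : cloudIndicator ε (S ω) x =
      {N : ℕ∞ | N ≠ 0}.indicator 1 (pointCount S (Metric.ball x ε) ω) := by
  unfold cloudIndicator
  rw [← Metric.eball_ofReal]
  simp only [infEDist_lt_iff_pointCount, Set.indicator, Set.mem_ofPred_eq, Pi.one_apply]

namespace IsPoissonProcess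

variable {Ω : Type*} [MeasurableSpace Ω] {P : Measure Ω} {ε : ℝ} {ρ : Space d → ℝ}
  {S : Ω → Set (Space d)}

theorem measurable_infEDist (hS : IsPoissonProcess P ε ρ S) :
    Measurable fun q : Ω × Space d => Metric.infEDist q.2 (S q.1) := by
  have hx : ∀ x, Measurable fun ω => Metric.infEDist x (S ω) := fun x => by
    refine measurable_of_Iio fun r => ?_
    have : (fun ω => Metric.infEDist x (S ω)) ⁻¹' Set.Iio r =
        pointCount S (Metric.eball x r) ⁻¹' {N | N ≠ 0} := by
      ext ω
      exact infEDist_lt_iff_pointCount S x r ω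
    rw [this]
    exact hS.measurable_count _ Metric.isOpen_eball.measurableSet .of_discrete
  exact (measurable_uncurry_of_continuous_of_measurable
    (u := fun (x : Space d) (ω : Ω) => Metric.infEDist x (S ω))
    (fun ω => Metric.continuous_infEDist) hx).comp measurable_swap

theorem measurable_cloudIndicator (hS : IsPoissonProcess P ε ρ S) :
    Measurable fun q : Ω × Space d => cloudIndicator ε (S q.1) q.2 :=
  Measurable.ite (measurableSet_lt hS.measurable_infEDist measurable_const)
    measurable_const measurable_const

theorem measurable_cloudIndicator_left (hS : IsPoissonProcess P ε ρ S) (x : Space d) :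
    Measurable fun ω => cloudIndicator ε (S ω) x := by
  simp_rw [cloudIndicator_eq_pointCount]
  exact (Measurable.of_discrete (f := {N : ℕ∞ | N ≠ 0}.indicator (1 : ℕ∞ → ℝ))).comp
    (hS.measurable_count (Metric.ball x ε) Metric.isOpen_ball.measurableSet)

theorem integrable_cloudIndicator [IsProbabilityMeasure P] (hS : IsPoissonProcess P ε ρ S)
    (x : Space d) : Integrable (fun ω => cloudIndicator ε (S ω) x) P :=
  Integrable.of_bound (hS.measurable_cloudIndicator_left x).aestronglyMeasurable 1
    (ae_of_all _ fun ω => by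
      rw [Real.norm_of_nonneg (cloudIndicator_nonneg _ _ _)]
      exact cloudIndicator_le_one _ _ _)

end IsPoissonProcess

/-- Over a ball of radius `ε` the mean number of points is the average of `ρ`, hence close to the
value of `ρ` at the centre. -/
theorem meanCount_ball_mem {α H : ℝ≥0} {ρ : Space d → ℝ} (hρ : HolderWith H α ρ)
    {ε : ℝ} (hε : 0 < ε) (x : Space d) :
    ENNReal.ofReal (ρ x - H * ε ^ (α : ℝ)) ≤ meanCount ε ρ (Metric.ball x ε) ∧
      meanCount ε ρ (Metric.ball x ε) ≤ ENNReal.ofReal (ρ x + H * ε ^ (α : ℝ)) := by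
  have hvol : volume (Metric.ball x ε) =
      volume (Metric.ball (0 : Space d) 1) * ENNReal.ofReal ε ^ d := by
    rw [Measure.addHaar_ball_of_pos _ x hε, finrank_euclideanSpace, Fintype.card_fin, mul_comm,
      ENNReal.ofReal_pow hε.le]
  have h0 : volume (Metric.ball x ε) ≠ 0 := (Metric.measure_ball_pos volume x hε).ne'
  have htop : volume (Metric.ball x ε) ≠ ∞ := measure_ball_lt_top.ne
  have hdist : ∀ y ∈ Metric.ball x ε, |ρ y - ρ x| ≤ H * ε ^ (α : ℝ) := fun y hy => by
    have h := hρ.dist_le y x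
    rw [Real.dist_eq] at h
    refine h.trans ?_
    gcongr
    exact (Metric.mem_ball.1 hy).le
  rw [meanCount, ← hvol, ENNReal.le_div_iff_mul_le (.inl h0) (.inl htop),
    ENNReal.div_le_iff h0 htop, ← setLIntegral_const, ← setLIntegral_const]
  refine ⟨setLIntegral_mono' Metric.isOpen_ball.measurableSet fun y hy => ?_,
    setLIntegral_mono' Metric.isOpen_ball.measurableSet fun y hy => ?_⟩
  · have := abs_le.1 (hdist y hy)
    exact ENNReal.ofReal_le_ofReal (by linarith [this.1])
  · have := abs_le.1 (hdist y hy)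
    exact ENNReal.ofReal_le_ofReal (by linarith [this.2])

theorem abs_exp_neg_sub_exp_neg_le {a b : ℝ} (ha : 0 ≤ a) (hb : 0 ≤ b) :
    |Real.exp (-a) - Real.exp (-b)| ≤ |a - b| := by
  wlog h : a ≤ b generalizing a b
  · rw [abs_sub_comm, abs_sub_comm a]
    exact this hb ha (le_of_not_ge h)
  rw [abs_of_nonneg (sub_nonneg.2 (Real.exp_le_exp.2 (by linarith))), abs_of_nonpos (by linarith)]
  have h1 : Real.exp (-b) = Real.exp (-a) * Real.exp (a - b) := by
    rw [← Real.exp_add]; ring_nf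
  have h2 := Real.add_one_le_exp (a - b)
  have h3 : Real.exp (-a) ≤ 1 := Real.exp_le_one_iff.2 (by linarith)
  have h4 : 0 < Real.exp (-a) := Real.exp_pos _
  rw [h1]
  nlinarith

namespace IsPoissonProcess

variable {Ω : Type*} [MeasurableSpace Ω] {P : Measure Ω} [IsProbabilityMeasure P] {ε : ℝ}
  {ρ : Space d → ℝ} {S : Ω → Set (Space d)}

/-- The probability that a ball contains a point of the process. -/
theorem integral_cloudIndicator (hS : IsPoissonProcess P ε ρ S) (x : Space d)
    (hfin : meanCount ε ρ (Metric.ball x ε) ≠ ∞) :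
    ∫ ω, cloudIndicator ε (S ω) x ∂P =
      1 - Real.exp (-(meanCount ε ρ (Metric.ball x ε)).toReal) := by
  have hm := hS.measurable_count (Metric.ball x ε) Metric.isOpen_ball.measurableSet
  have h0 : P.real (pointCount S (Metric.ball x ε) ⁻¹' {0}) =
      Real.exp (-(meanCount ε ρ (Metric.ball x ε)).toReal) := by
    rw [← map_measureReal_apply hm (.of_discrete), hS.law _ Metric.isOpen_ball.measurableSet hfin,
      map_measureReal_apply .of_discrete (.of_discrete)]
    have : (fun n : ℕ => (n : ℕ∞)) ⁻¹' {0} = {0} := by ext; simp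
    rw [this, poissonMeasure_real_singleton, ENNReal.coe_toNNReal_eq_toReal]
    simp
  have hset : (fun ω => cloudIndicator ε (S ω) x) =
      (pointCount S (Metric.ball x ε) ⁻¹' {0})ᶜ.indicator 1 := by
    ext ω
    rw [cloudIndicator_eq_pointCount]
    rfl
  rw [hset, integral_indicator_one (hm (.of_discrete)).compl, probReal_compl_eq_one_sub
    (hm (.of_discrete)), h0]

theorem abs_integral_cloudIndicator_sub_le {α H : ℝ≥0} (hS : IsPoissonProcess P ε ρ S)
    (hε : 0 < ε) (hρ : HolderWith H α ρ) (hρ0 : ∀ x, 0 ≤ ρ x) (x : Space d) :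
    |∫ ω, cloudIndicator ε (S ω) x ∂P - macroProb ρ x| ≤ H * ε ^ (α : ℝ) := by
  obtain ⟨h1, h2⟩ := meanCount_ball_mem hρ hε x
  have hfin : meanCount ε ρ (Metric.ball x ε) ≠ ∞ := (h2.trans_lt ENNReal.ofReal_lt_top).ne
  have hδ : 0 ≤ H * ε ^ (α : ℝ) := by positivity
  rw [hS.integral_cloudIndicator x hfin, macroProb, sub_sub_sub_cancel_left, abs_sub_comm]
  refine (abs_exp_neg_sub_exp_neg_le ENNReal.toReal_nonneg (hρ0 x)).trans (abs_le.2 ⟨?_, ?_⟩)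
  · have := (ENNReal.ofReal_le_iff_le_toReal hfin).1 h1
    linarith
  · have := ENNReal.toReal_le_of_le_ofReal (add_nonneg (hρ0 x) hδ) h2
    linarith

/-- The fluctuation of the cloud of balls about its mean is a short range field, since the
neighbourhoods of radius `ε` of points of distance at least `2ε` are disjoint. -/
theorem isShortRange (hS : IsPoissonProcess P ε ρ S) :
    IsShortRange P (2 * ε) fun ω x =>
      ((cloudIndicator ε (S ω) x - ∫ ω', cloudIndicator ε (S ω') x ∂P : ℝ) : ℂ) where
  measurable := by
    have h : Measurable fun x => ∫ ω', cloudIndicator ε (S ω') x ∂P :=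
      (hS.measurable_cloudIndicator.stronglyMeasurable.integral_prod_left').measurable
    exact Complex.measurable_ofReal.comp
      (hS.measurable_cloudIndicator.sub (h.comp measurable_snd))
  norm_le_one ω x := by
    have h0 : 0 ≤ ∫ ω', cloudIndicator ε (S ω') x ∂P :=
      integral_nonneg fun _ => cloudIndicator_nonneg _ _ _
    have h1 : ∫ ω', cloudIndicator ε (S ω') x ∂P ≤ 1 := by
      refine (integral_mono (hS.integrable_cloudIndicator x) (integrable_const 1)
        fun _ => cloudIndicator_le_one _ _ _).trans_eq ?_
      simp
    rw [Complex.norm_real, Real.norm_eq_abs, abs_le]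
    constructor <;> linarith [cloudIndicator_nonneg ε (S ω) x, cloudIndicator_le_one ε (S ω) x]
  uncorrelated y z hyz := by
    -- The two values are functions of the numbers of points in two disjoint balls.
    have hind : IndepFun (pointCount S (Metric.ball y ε)) (pointCount S (Metric.ball z ε)) P := by
      have hdisj : Disjoint (Metric.ball y ε) (Metric.ball z ε) :=
        Metric.ball_disjoint_ball (by linarith)
      have h := hS.indep 2 ![Metric.ball y ε, Metric.ball z ε]
        (by intro i; fin_cases i <;> exact Metric.isOpen_ball.measurableSet)
        (by
          intro i j hij
          fin_cases i <;> fin_cases j <;> first | exact absurd rfl hij | exact hdisj | exact hdisj.symm)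
      exact h.indepFun (i := 0) (j := 1) (by decide)
    set my := ∫ ω', cloudIndicator ε (S ω') y ∂P with hmy
    set mz := ∫ ω', cloudIndicator ε (S ω') z ∂P with hmz
    have hind' : IndepFun (fun ω => cloudIndicator ε (S ω) y - my)
        (fun ω => cloudIndicator ε (S ω) z - mz) P := by
      simp_rw [cloudIndicator_eq_pointCount]
      exact hind.comp (φ := fun N => {N : ℕ∞ | N ≠ 0}.indicator 1 N - my)
        (ψ := fun N => {N : ℕ∞ | N ≠ 0}.indicator 1 N - mz) .of_discrete .of_discrete
    have hzero : ∫ ω, (cloudIndicator ε (S ω) y - my) ∂P = 0 := by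
      rw [integral_sub (hS.integrable_cloudIndicator y) (integrable_const _), ← hmy]
      simp
    simp_rw [Complex.conj_ofReal, ← Complex.ofReal_mul]
    rw [integral_complex_ofReal, hind'.integral_fun_mul_eq_mul_integral
      ((hS.measurable_cloudIndicator_left y).sub_const _).aestronglyMeasurable
      ((hS.measurable_cloudIndicator_left z).sub_const _).aestronglyMeasurable, hzero]
    simp

end IsPoissonProcess

/-! ### The coefficients -/

/-- A point of the upper half plane lies in the disc of radius `t` about `i t`, for large `t`. -/
theorem norm_sub_I_mul_lt {z : ℂ} (hz : 0 < z.im) {t : ℝ} (ht : Complex.normSq z / z.im ≤ t) :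
    ‖z - Complex.I * t‖ < t := by
  have hz0 : 0 < Complex.normSq z := Complex.normSq_pos.2 fun h => by simp [h] at hz
  have ht0 : 0 < t := (div_pos hz0 hz).trans_le ht
  rw [div_le_iff₀ hz, Complex.normSq_apply] at ht
  rw [Complex.normSq_apply] at hz0
  refine (sq_lt_sq₀ (norm_nonneg _) ht0.le).1 ?_
  rw [Complex.sq_norm, Complex.normSq_apply]
  simp
  nlinarith

theorem exists_disc {n₀ n₁ : ℂ} (h₀ : 0 < n₀.im) (h₁ : 0 < n₁.im) :
    ∃ (t : ℝ) (θ : ℝ≥0), 0 < t ∧ θ < 1 ∧ ‖n₀ - Complex.I * t‖ ≤ θ * t ∧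
      ‖n₁ - Complex.I * t‖ ≤ θ * t := by
  set t := max (Complex.normSq n₀ / n₀.im) (Complex.normSq n₁ / n₁.im) with ht
  have l₀ := norm_sub_I_mul_lt h₀ (le_max_left _ _ : _ ≤ t)
  have l₁ := norm_sub_I_mul_lt h₁ (le_max_right _ _ : _ ≤ t)
  have ht0 : 0 < t := (norm_nonneg _).trans_lt l₀
  have hm : 0 ≤ max ‖n₀ - Complex.I * t‖ ‖n₁ - Complex.I * t‖ :=
    (norm_nonneg _).trans (le_max_left _ _)
  refine ⟨t, NNReal.mk (max ‖n₀ - Complex.I * t‖ ‖n₁ - Complex.I * t‖ / t) (by positivity), ht0, ?_, ?_, ?_⟩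
  · rw [← NNReal.coe_lt_coe]
    exact (div_lt_one ht0).2 (max_lt l₀ l₁)
  · rw [NNReal.coe_mk, div_mul_cancel₀ _ ht0.ne']
    exact le_max_left _ _
  · rw [NNReal.coe_mk, div_mul_cancel₀ _ ht0.ne']
    exact le_max_right _ _

theorem macroProb_nonneg {ρ : Space d → ℝ} (hρ : ∀ x, 0 ≤ ρ x) (x : Space d) :
    0 ≤ macroProb ρ x :=
  sub_nonneg.2 (Real.exp_le_one_iff.2 (neg_nonpos.2 (hρ x)))

theorem macroProb_le_one (ρ : Space d → ℝ) (x : Space d) : macroProb ρ x ≤ 1 :=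
  sub_le_self _ (Real.exp_pos _).le

theorem measurable_macroProb {ρ : Space d → ℝ} (hρ : Measurable ρ) : Measurable (macroProb ρ) :=
  measurable_const.sub (Real.measurable_exp.comp hρ.neg)

theorem isNearImaginary_cloudIndex {t θ : ℝ} {n₀ n₁ : ℂ} (h₀ : ‖n₀ - Complex.I * t‖ ≤ θ * t)
    (h₁ : ‖n₁ - Complex.I * t‖ ≤ θ * t) (ε : ℝ) (S : Set (Space d)) :
    IsNearImaginary t θ (cloudIndex n₀ n₁ ε S) where
  measurable := Measurable.ite
    (measurableSet_lt Metric.continuous_infEDist.measurable measurable_const)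
    measurable_const measurable_const
  norm_sub_le x := by
    unfold cloudIndex
    split_ifs
    exacts [h₁, h₀]

theorem isNearImaginary_effectiveIndex {t θ : ℝ} {n₀ n₁ : ℂ} (h₀ : ‖n₀ - Complex.I * t‖ ≤ θ * t)
    (h₁ : ‖n₁ - Complex.I * t‖ ≤ θ * t) {ρ : Space d → ℝ} (hρm : Measurable ρ)
    (hρ : ∀ x, 0 ≤ ρ x) : IsNearImaginary t θ (effectiveIndex n₀ n₁ ρ) where
  measurable := by
    have h := Complex.measurable_ofReal.comp (measurable_macroProb hρm)
    exact (h.mul_const _).add ((measurable_const.sub h).mul_const _)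
  norm_sub_le x := by
    set p := macroProb ρ x with hp
    have hp0 : 0 ≤ p := macroProb_nonneg hρ x
    have hp1 : 0 ≤ 1 - p := sub_nonneg.2 (macroProb_le_one ρ x)
    have e : effectiveIndex n₀ n₁ ρ x - Complex.I * t =
        (p : ℂ) * (n₁ - Complex.I * t) + ((1 - p : ℝ) : ℂ) * (n₀ - Complex.I * t) := by
      rw [effectiveIndex, ← hp]
      push_cast
      ring
    rw [e]
    calc _ ≤ p * ‖n₁ - Complex.I * t‖ + (1 - p) * ‖n₀ - Complex.I * t‖ := by
          refine (norm_add_le _ _).trans_eq ?_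
          rw [norm_mul, norm_mul, Complex.norm_of_nonneg hp0, Complex.norm_of_nonneg hp1]
      _ ≤ p * (θ * t) + (1 - p) * (θ * t) := by gcongr
      _ = θ * t := by ring

/-! ### The error estimate -/

/-- The rate `ε^(2α)` dominates `ε^d` for small `ε`, and one for large `ε`. -/
theorem min_rpow_le {α : ℝ} (hα : 0 ≤ α) (hα' : α ≤ 1) (hd : 2 ≤ d) {ε : ℝ} (hε : 0 < ε) :
    min (ε ^ d) 1 ≤ ε ^ (2 * α) := by
  rcases le_total ε 1 with h | h
  · refine (min_le_left _ _).trans ?_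
    rw [← Real.rpow_natCast]
    refine Real.rpow_le_rpow_of_exponent_ge hε h ?_
    have : (2 : ℝ) ≤ d := by exact_mod_cast hd
    linarith
  · exact (min_le_right _ _).trans (Real.one_le_rpow h (by positivity))

theorem IsShortRange.integral_norm_resolvent_sq_le_rpow {Ω : Type*} [MeasurableSpace Ω]
    {P : Measure Ω} [IsProbabilityMeasure P] {Z : Ω → Space d → ℂ} {ε : ℝ} (hε : 0 < ε)
    (hZ : IsShortRange P (2 * ε) Z) {τ : ℝ} (hτ : 0 < τ) (hd : 2 ≤ d) (hd' : d < 4) {α : ℝ}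
    (hα : 0 ≤ α) (hα' : α ≤ 1) (u : L2 d) :
    ∫ ω, ‖resolvent hτ (mulOp (Z ω) (hZ.memLp ω) u)‖ ^ 2 ∂P ≤
      (4 * (∫ ξ : Space d, ‖resolventSymbol τ ξ‖ ^ 2) *
        (2 ^ d * (volume (Metric.ball (0 : Space d) 1)).toReal) + (τ⁻¹) ^ 2) *
        ε ^ (2 * α) * ‖u‖ ^ 2 := by
  have hA : 0 ≤ ∫ ξ : Space d, ‖resolventSymbol τ ξ‖ ^ 2 := integral_nonneg fun ξ => by positivity
  set A := ∫ ξ : Space d, ‖resolventSymbol τ ξ‖ ^ 2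
  have hB : 0 ≤ (volume (Metric.ball (0 : Space d) 1)).toReal := ENNReal.toReal_nonneg
  have h1 := hZ.integral_norm_resolvent_sq_le hτ hd' u
  rw [Measure.addHaar_ball_of_pos _ _ (by positivity), ENNReal.toReal_mul,
    ENNReal.toReal_ofReal (by positivity), finrank_euclideanSpace, Fintype.card_fin, mul_pow] at h1
  set B := (volume (Metric.ball (0 : Space d) 1)).toReal
  have h2 : ∫ ω, ‖resolvent hτ (mulOp (Z ω) (hZ.memLp ω) u)‖ ^ 2 ∂P ≤ (τ⁻¹) ^ 2 * ‖u‖ ^ 2 := by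
    refine (integral_mono (hZ.integrable_norm_resolvent_mulOp_sq hτ u)
      (integrable_const ((τ⁻¹ * ‖u‖) ^ 2)) fun ω => ?_).trans_eq ?_
    · exact pow_le_pow_left₀ (norm_nonneg _) (hZ.norm_resolvent_mulOp_le hτ u ω) 2
    · simp [mul_pow]
  have h3 : ∫ ω, ‖resolvent hτ (mulOp (Z ω) (hZ.memLp ω) u)‖ ^ 2 ∂P ≤
      (4 * A * (2 ^ d * B) + (τ⁻¹) ^ 2) * min (ε ^ d) 1 * ‖u‖ ^ 2 := by
    rcases min_choice (ε ^ d) 1 with h | h <;> rw [h]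
    · have : 0 ≤ (τ⁻¹) ^ 2 * ε ^ d * ‖u‖ ^ 2 := by positivity
      calc _ ≤ _ := h1
        _ = 4 * A * (2 ^ d * B) * ε ^ d * ‖u‖ ^ 2 := by ring
        _ ≤ _ := by linarith
    · have : 0 ≤ 4 * A * (2 ^ d * B) * ‖u‖ ^ 2 := by positivity
      linarith
  refine h3.trans ?_
  gcongr
  exact min_rpow_le hα hα' hd hε

/-- For each realization the error is controlled by the averaged fluctuation and by the bias of
the coefficient. -/
theorem IsPoissonProcess.norm_sub_sq_le {Ω : Type*} [MeasurableSpace Ω] {P : Measure Ω}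
    [IsProbabilityMeasure P] {ε : ℝ} {ρ : Space d → ℝ} {S : Ω → Set (Space d)}
    (hS : IsPoissonProcess P ε ρ S) (hε : 0 < ε) {α H : ℝ≥0} (hα : 0 < α)
    (hρ : HolderWith H α ρ) (hρ0 : ∀ x, 0 ≤ ρ x) {k t : ℝ} {θ : ℝ≥0} (hτ : 0 < k ^ 2 * t)
    (hθ : θ < 1) {n₀ n₁ : ℂ} (h₀ : ‖n₀ - Complex.I * t‖ ≤ θ * t)
    (h₁ : ‖n₁ - Complex.I * t‖ ≤ θ * t) {f u v : L2 d} (ω : Ω)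
    (hu : IsHelmholtzSolution k (effectiveIndex n₀ n₁ ρ) f u)
    (hv : IsHelmholtzSolution k (cloudIndex n₀ n₁ ε (S ω)) f v) :
    ‖v - u‖ ^ 2 ≤ 2 * (k ^ 2 / (1 - θ) * ‖n₁ - n₀‖) ^ 2 *
      (‖resolvent hτ (mulOp _ (hS.isShortRange.memLp ω) u)‖ ^ 2 +
        ((k ^ 2 * t)⁻¹) ^ 2 * (H : ℝ) ^ 2 * ε ^ (2 * (α : ℝ)) * ‖u‖ ^ 2) := by
  have hρm : Measurable ρ := (hρ.continuous hα).measurable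
  have hq := isNearImaginary_cloudIndex h₀ h₁ ε (S ω)
  have hq' := isNearImaginary_effectiveIndex h₀ h₁ hρm hρ0
  have hqq' : MemLp (fun x => cloudIndex n₀ n₁ ε (S ω) x - effectiveIndex n₀ n₁ ρ x) ∞
    (volume : Measure (Space d)) := hq.memLp.sub hq'.memLp
  let β : Space d → ℂ := fun x =>
    ((∫ ω', cloudIndicator ε (S ω') x ∂P - macroProb ρ x : ℝ) : ℂ)
  have hβm : Measurable β := by
    have h : Measurable fun x => ∫ ω', cloudIndicator ε (S ω') x ∂P :=
      (hS.measurable_cloudIndicator.stronglyMeasurable.integral_prod_left').measurable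
    exact Complex.measurable_ofReal.comp (h.sub (measurable_macroProb hρm))
  have hβ : ∀ x, ‖β x‖ ≤ H * ε ^ (α : ℝ) := fun x => by
    rw [Complex.norm_real]
    exact hS.abs_integral_cloudIndicator_sub_le hε hρ hρ0 x
  have hβL := memLp_top_of_measurable_of_bound hβm hβ
  have hsplit : mulOp _ hqq' u = (n₁ - n₀) •
      (mulOp _ (hS.isShortRange.memLp ω) u + mulOp β hβL u) := by
    ext1
    filter_upwards [mulOp_ae _ hqq' u, mulOp_ae _ (hS.isShortRange.memLp ω) u, mulOp_ae β hβL u,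
      Lp.coeFn_smul (n₁ - n₀) (mulOp _ (hS.isShortRange.memLp ω) u + mulOp β hβL u),
      Lp.coeFn_add (mulOp _ (hS.isShortRange.memLp ω) u) (mulOp β hβL u)] with x e1 e2 e3 e4 e5
    rw [e4, Pi.smul_apply, e5, Pi.add_apply, e1, e2, e3, cloudIndex_eq, effectiveIndex]
    simp only [β, smul_eq_mul]
    push_cast
    ring
  have hstab := norm_sub_le_norm_resolvent hτ hθ hq hq' hqq' hv hu
  rw [hsplit, map_smul, norm_smul, map_add, ← mul_assoc] at hstab
  have hbias : ‖resolvent hτ (mulOp β hβL u)‖ ≤ (k ^ 2 * t)⁻¹ * (H * ε ^ (α : ℝ) * ‖u‖) := by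
    refine (norm_resolvent_le hτ _).trans ?_
    gcongr
    exact norm_mulOp_le hβL hβ u
  have hθ' : 0 < 1 - (θ : ℝ) := sub_pos.2 (by exact_mod_cast hθ)
  set K := k ^ 2 / (1 - θ) * ‖n₁ - n₀‖ with hK
  have hK0 : 0 ≤ K := by positivity
  set a := ‖resolvent hτ (mulOp _ (hS.isShortRange.memLp ω) u)‖ with ha
  set b := (k ^ 2 * t)⁻¹ * (H * ε ^ (α : ℝ) * ‖u‖) with hb
  have h3 : ‖v - u‖ ≤ K * (a + b) :=
    hstab.trans (by gcongr; exact (norm_add_le _ _).trans (by gcongr))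
  have hpow : ε ^ (2 * (α : ℝ)) = (ε ^ (α : ℝ)) ^ 2 := by
    rw [mul_comm, Real.rpow_mul hε.le, Real.rpow_two]
  have hb2 : ((k ^ 2 * t)⁻¹) ^ 2 * (H : ℝ) ^ 2 * ε ^ (2 * (α : ℝ)) * ‖u‖ ^ 2 = b ^ 2 := by
    rw [hpow, hb]
    ring
  rw [hb2]
  calc ‖v - u‖ ^ 2 ≤ (K * (a + b)) ^ 2 := by gcongr
    _ = K ^ 2 * (a + b) ^ 2 := mul_pow _ _ _
    _ ≤ K ^ 2 * (2 * (a ^ 2 + b ^ 2)) := by gcongr; exact add_sq_le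
    _ = _ := by ring

/-- The constant of the error estimate: `(τ⁻¹)²` and the `L²` norm of the resolvent symbol,
`τ = k² t`, bound the contribution of the fluctuation of the coefficient for `ε ≥ 1` and `ε ≤ 1`
respectively, and the term with the Hölder constant `H` bounds that of its bias. -/
noncomputable def errorConst (d : ℕ) (k t : ℝ) (θ H : ℝ≥0) (n₀ n₁ : ℂ) : ℝ :=
  2 * (k ^ 2 / (1 - θ) * ‖n₁ - n₀‖) ^ 2 *
    ((4 * (∫ ξ : Space d, ‖resolventSymbol (k ^ 2 * t) ξ‖ ^ 2) *
      (2 ^ d * (volume (Metric.ball (0 : Space d) 1)).toReal) + ((k ^ 2 * t)⁻¹) ^ 2) +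
      ((k ^ 2 * t)⁻¹) ^ 2 * (H : ℝ) ^ 2)

theorem IsPoissonProcess.integral_norm_sub_sq_le {Ω : Type*} [MeasurableSpace Ω] {P : Measure Ω}
    [IsProbabilityMeasure P] {ε : ℝ} {ρ : Space d → ℝ} {S : Ω → Set (Space d)}
    (hS : IsPoissonProcess P ε ρ S) (hε : 0 < ε) (hd : 2 ≤ d) (hd' : d < 4) {α H : ℝ≥0}
    (hα : 0 < α) (hα' : α ≤ 1) (hρ : HolderWith H α ρ) (hρ0 : ∀ x, 0 ≤ ρ x) {k t : ℝ} {θ : ℝ≥0}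
    (hτ : 0 < k ^ 2 * t) (hθ : θ < 1) {n₀ n₁ : ℂ} (h₀ : ‖n₀ - Complex.I * t‖ ≤ θ * t)
    (h₁ : ‖n₁ - Complex.I * t‖ ≤ θ * t) {f u : L2 d} {v : Ω → L2 d}
    (hu : IsHelmholtzSolution k (effectiveIndex n₀ n₁ ρ) f u)
    (hv : ∀ᵐ ω ∂P, IsHelmholtzSolution k (cloudIndex n₀ n₁ ε (S ω)) f (v ω)) :
    Integrable (fun ω => ‖v ω - u‖ ^ 2) P ∧
      ∫ ω, ‖v ω - u‖ ^ 2 ∂P ≤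
        errorConst d k t θ H n₀ n₁ * ε ^ (2 * (α : ℝ)) * ‖u‖ ^ 2 := by
  have hZ := hS.isShortRange
  set Y := fun ω => ‖resolvent hτ (mulOp _ (hZ.memLp ω) u)‖ ^ 2 with hY
  have hYi : Integrable Y P := hZ.integrable_norm_resolvent_mulOp_sq hτ u
  set K := 2 * (k ^ 2 / (1 - θ) * ‖n₁ - n₀‖) ^ 2 with hK
  have hK0 : 0 ≤ K := by positivity
  set b := ((k ^ 2 * t)⁻¹) ^ 2 * (H : ℝ) ^ 2 * ε ^ (2 * (α : ℝ)) * ‖u‖ ^ 2 with hb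
  have hq := fun ω => isNearImaginary_cloudIndex h₀ h₁ ε (S ω)
  have hqm : Measurable (Function.uncurry fun ω => cloudIndex n₀ n₁ ε (S ω)) :=
    Measurable.ite (measurableSet_lt hS.measurable_infEDist measurable_const)
      measurable_const measurable_const
  have hle : ∀ᵐ ω ∂P, ‖v ω - u‖ ^ 2 ≤ K * (Y ω + b) := by
    filter_upwards [hv] with ω hω
    exact hS.norm_sub_sq_le hε hα hρ hρ0 hτ hθ h₀ h₁ ω hu hω
  have hbound : Integrable (fun ω => K * (Y ω + b)) P := (hYi.add (integrable_const b)).const_mul K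
  -- Almost surely `v` is the solution, which depends measurably on the realization.
  have hvm : AEStronglyMeasurable v P := by
    choose w hw hw' using fun ω => existsUnique_isHelmholtzSolution hτ hθ (hq ω) f
    refine ⟨w, stronglyMeasurable_of_isHelmholtzSolution hτ hθ hqm hq f hw, ?_⟩
    filter_upwards [hv] with ω hω
    exact hw' ω _ hω
  have hi : Integrable (fun ω => ‖v ω - u‖ ^ 2) P := by
    refine hbound.mono' ((hvm.sub aestronglyMeasurable_const).norm.pow 2) ?_
    filter_upwards [hle] with ω hω
    rwa [Real.norm_of_nonneg (by positivity)]
  refine ⟨hi, (integral_mono_ae hi hbound hle).trans ?_⟩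
  rw [integral_const_mul, integral_add hYi (integrable_const b), errorConst, ← hK, mul_assoc K, mul_assoc K, add_mul,
    add_mul]
  simp only [integral_const, probReal_univ, one_smul]
  gcongr
  exact hZ.integral_norm_resolvent_sq_le_rpow hε hτ hd hd' α.2 (by exact_mod_cast hα') u

theorem IsPoissonProcess.integral_cloudIndex {Ω : Type*} [MeasurableSpace Ω] {P : Measure Ω}
    [IsProbabilityMeasure P] {ε : ℝ} {ρ : Space d → ℝ} {S : Ω → Set (Space d)}
    (hS : IsPoissonProcess P ε ρ S) (n₀ n₁ : ℂ) (x : Space d) :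
    Integrable (fun ω => cloudIndex n₀ n₁ ε (S ω) x) P ∧
      ∫ ω, cloudIndex n₀ n₁ ε (S ω) x ∂P =
        n₀ + (n₁ - n₀) * ((∫ ω, cloudIndicator ε (S ω) x ∂P : ℝ) : ℂ) := by
  have hi : Integrable (fun ω => (n₁ - n₀) * (cloudIndicator ε (S ω) x : ℂ)) P :=
    (hS.integrable_cloudIndicator x).ofReal.const_mul _
  simp_rw [cloudIndex_eq]
  refine ⟨(integrable_const _).add hi, ?_⟩
  rw [integral_add (integrable_const _) hi, integral_const_mul, integral_complex_ofReal]
  simp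

end PoissonHelmholtz

theorem mainTheorem1
    (d : ℕ) (hd : d = 2 ∨ d = 3)
    (k κ₀ κ₁ n : ℝ) (hk : 0 < k) (hκ₀ : 0 < κ₀) (hκ₁ : 0 < κ₁) (hn : 0 < n)
    (α : ℝ≥0) (hα : 0 < α) (hα' : α ≤ 1) (H V : ℝ≥0) :
    ∃ C : ℝ, ∀ (D : Set (Space d)) (ρ : Space d → ℝ),
      IsOpen D → Bornology.IsBounded D → volume D = (V : ℝ≥0∞) →
      (∀ x, 0 ≤ ρ x) → tsupport ρ ⊆ closure D →
      MemHolder α ρ → nnHolderNorm α ρ = H →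
      -- the homogenized equation is uniquely solvable in `L²`
      (∀ f : L2 d, ∃! u : L2 d, IsHelmholtzSolution k (effectiveIndex (waterIndex κ₀) (sandIndex n κ₁) ρ) f u) ∧
      -- for each scale: unique solvability of the heterogeneous equation and the error estimate
      (∀ ε : ℝ, 0 < ε → ∀ (Ω : Type*) [MeasurableSpace Ω] (P : Measure Ω) [IsProbabilityMeasure P]
        (S : Ω → Set (Space d)),
        IsPoissonProcess P ε ρ S →
        ∀ f : L2 d,
          (∀ ω, ∃! v : L2 d, IsHelmholtzSolution k (cloudIndex (waterIndex κ₀) (sandIndex n κ₁) ε (S ω)) f v) ∧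
          ∀ (u : L2 d) (uε : Ω → L2 d),
            IsHelmholtzSolution k (effectiveIndex (waterIndex κ₀) (sandIndex n κ₁) ρ) f u →
            (∀ᵐ ω ∂P, IsHelmholtzSolution k (cloudIndex (waterIndex κ₀) (sandIndex n κ₁) ε (S ω)) f (uε ω)) →
            Integrable (fun ω => ‖uε ω - u‖ ^ 2) P ∧
            ∫ ω, ‖uε ω - u‖ ^ 2 ∂P ≤ C * ε ^ (2 * (α : ℝ)) * ‖u‖ ^ 2) ∧
      -- as `ε → 0`: the coefficients converge in mean and the solutions in mean square
      (∀ (Ω : ℝ → Type*) [∀ ε, MeasurableSpace (Ω ε)] (P : ∀ ε, Measure (Ω ε))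
        [∀ ε, IsProbabilityMeasure (P ε)]
        (S : ∀ ε, Ω ε → Set (Space d)),
        (∀ ε : ℝ, 0 < ε → IsPoissonProcess (P ε) ε ρ (S ε)) →
        (∀ x, (∀ ε : ℝ, 0 < ε → Integrable (fun ω => cloudIndex (waterIndex κ₀) (sandIndex n κ₁) ε (S ε ω) x) (P ε)) ∧
          Tendsto (fun ε => ∫ ω, cloudIndex (waterIndex κ₀) (sandIndex n κ₁) ε (S ε ω) x ∂(P ε)) (𝓝[>] 0)
            (𝓝 (effectiveIndex (waterIndex κ₀) (sandIndex n κ₁) ρ x))) ∧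
        ∀ (f u : L2 d) (uε : ∀ ε, Ω ε → L2 d),
          IsHelmholtzSolution k (effectiveIndex (waterIndex κ₀) (sandIndex n κ₁) ρ) f u →
          (∀ ε : ℝ, 0 < ε → ∀ᵐ ω ∂(P ε), IsHelmholtzSolution k (cloudIndex (waterIndex κ₀) (sandIndex n κ₁) ε (S ε ω)) f (uε ε ω)) →
          Tendsto (fun ε => ∫ ω, ‖uε ε ω - u‖ ^ 2 ∂(P ε)) (𝓝[>] 0) (𝓝 0)) := by
  have hd2 : 2 ≤ d := by omega
  have hd4 : d < 4 := by omega
  obtain ⟨t, θ, ht, hθ, h₀, h₁⟩ := exists_disc (n₀ := waterIndex κ₀) (n₁ := sandIndex n κ₁)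
    (by simpa [waterIndex] using hκ₀) (by simpa [sandIndex, ← Complex.ofReal_pow] using hκ₁)
  have hτ : 0 < k ^ 2 * t := by positivity
  refine ⟨errorConst d k t θ H (waterIndex κ₀) (sandIndex n κ₁), fun D ρ _ _ _ hρ0 _ hρ hH => ?_⟩
  have hρH : HolderWith H α ρ := hH ▸ hρ.holderWith
  have hρm : Measurable ρ := (hρH.continuous hα).measurable
  refine ⟨fun f => existsUnique_isHelmholtzSolution hτ hθ
    (isNearImaginary_effectiveIndex h₀ h₁ hρm hρ0) f, ?_, ?_⟩
  · intro ε hε Ω _ P _ S hS f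
    refine ⟨fun ω => existsUnique_isHelmholtzSolution hτ hθ
      (isNearImaginary_cloudIndex h₀ h₁ ε (S ω)) f, fun u uε hu huε => ?_⟩
    exact hS.integral_norm_sub_sq_le hε hd2 hd4 hα hα' hρH hρ0 hτ hθ h₀ h₁ hu huε
  · intro Ω _ P _ S hS
    refine ⟨fun x => ⟨fun ε hε => ((hS ε hε).integral_cloudIndex _ _ x).1, ?_⟩,
      fun f u uε hu huε => ?_⟩
    · have hrate : Tendsto (fun ε : ℝ => (H : ℝ) * ε ^ (α : ℝ)) (𝓝[>] 0) (𝓝 0) := by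
        have h : ContinuousAt (fun ε : ℝ => (H : ℝ) * ε ^ (α : ℝ)) 0 :=
          continuousAt_const.mul (Real.continuousAt_rpow_const _ _ (.inr (by exact_mod_cast hα.le)))
        have h' := h.tendsto
        rw [Real.zero_rpow (by exact_mod_cast hα.ne'), mul_zero] at h'
        exact h'.mono_left nhdsWithin_le_nhds
      have hp : Tendsto (fun ε => ∫ ω, cloudIndicator ε (S ε ω) x ∂(P ε)) (𝓝[>] 0)
          (𝓝 (macroProb ρ x)) := by
        rw [tendsto_iff_dist_tendsto_zero]
        refine squeeze_zero' (Eventually.of_forall fun _ => dist_nonneg) ?_ hrate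
        filter_upwards [self_mem_nhdsWithin] with ε hε
        exact (hS ε hε).abs_integral_cloudIndicator_sub_le hε hρH hρ0 x
      have hlim : effectiveIndex (waterIndex κ₀) (sandIndex n κ₁) ρ x =
          waterIndex κ₀ + (sandIndex n κ₁ - waterIndex κ₀) * (macroProb ρ x : ℂ) := by
        rw [effectiveIndex]
        ring
      rw [hlim]
      refine Tendsto.congr' ?_ (tendsto_const_nhds.add (tendsto_const_nhds.mul
        ((Complex.continuous_ofReal.tendsto _).comp hp)))
      filter_upwards [self_mem_nhdsWithin] with ε hε
      exact ((hS ε hε).integral_cloudIndex _ _ x).2.symm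
    · refine squeeze_zero' (Eventually.of_forall fun ε => integral_nonneg fun ω => by positivity)
        (g := fun ε : ℝ => errorConst d k t θ H (waterIndex κ₀) (sandIndex n κ₁) *
          ε ^ (2 * (α : ℝ)) * ‖u‖ ^ 2) ?_ ?_
      · filter_upwards [self_mem_nhdsWithin] with ε hε
        exact ((hS ε hε).integral_norm_sub_sq_le hε hd2 hd4 hα hα' hρH hρ0 hτ hθ h₀ h₁ hu
          (huε ε hε)).2
      · have h : ContinuousAt (fun ε : ℝ => ε ^ (2 * (α : ℝ))) 0 :=
          Real.continuousAt_rpow_const _ _ (.inr (by positivity))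
        have h' := h.tendsto
        rw [Real.zero_rpow (by positivity)] at h'
        simpa using ((h'.mono_left nhdsWithin_le_nhds).const_mul _).mul_const (‖u‖ ^ 2)
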